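/- Let $\mathbb{Z}\rtimes\mathbb{Z}_2$ be the semidirect product in which the generator of $\mathbb{Z}_2=\mathbb{Z}/2\mathbb{Z}$ acts on $\mathbb{Z}$ by $n\mapsto -n$. Let $\alpha$ be a minimal action (every orbit is dense) of $\mathbb{Z}\rtimes\mathbb{Z}_2$ by homeomorphisms on the Cantor set $X$, and put $\varphi:=\alpha_{(1,0)}$ and $\sigma:=\alpha_{(0,1)}$, so that $\sigma^2=\mathrm{id}_X$, $\sigma\varphi\sigma=\varphi^{-1}$ and $\alpha_{(n,i)}=\varphi^n\sigma^i$. A homeomorphism is called minimal if the $\mathbb{Z}$-action it generates is minimal, and $\alpha$ is called free if $\alpha_g(x)=x$ for some $x\in X$ implies $g=e$. For a group $\Gamma$ acting by homeomorphisms on a space $Z$, the abelian group $C(Z,\mathbb{Z})$ of continuous integer-valued functions is a $\Gamma$-module via $(fg)(x)=f(gx)$, and $H_n(\Gamma,C(Z,\mathbb{Z}))$ denotes its $n$-th group homology. Let $H_n(\mathbb{Z},C(X,\mathbb{Z}))$ be formed with respect to the $\mathbb{Z}$-action generated by $\varphi$, let $\sigma_*$ be the endomorphism of $H_0(\mathbb{Z},C(X,\mathbb{Z}))$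 induced by $f\mapsto f\circ\sigma$, and let $(1+\sigma_*)H_0(\mathbb{Z},C(X,\mathbb{Z}))$ be the image of $1+\sigma_*$. Then the following hold, where $\simeq$ denotes isomorphism of abelian groups. (i) If $\varphi$ is not minimal, then there exists a clopen set $Y\subset X$ with $\varphi(Y)=Y$ such that $X=Y\sqcup\sigma(Y)$, $\varphi|_Y$ is minimal, and, with the $\mathbb{Z}$-action on $Y$ generated by $\varphi|_Y$, $$H_0(\mathbb{Z}\rtimes\mathbb{Z}_2,C(X,\mathbb{Z}))\simeq H_0(\mathbb{Z},C(Y,\mathbb{Z})).$$ Moreover $H_1(\mathbb{Z}\rtimes\mathbb{Z}_2,C(X,\mathbb{Z}))\simeq\mathbb{Z}$ and $H_n(\mathbb{Z}\rtimes\mathbb{Z}_2,C(X,\mathbb{Z}))=0$ for $n\geq 2$. (ii) If $\varphi$ is minimal and $\alpha$ is free, then $$H_0(\mathbb{Z}\rtimes\mathbb{Z}_2,C(X,\mathbb{Z}))\simeq\mathbb{Z}_2\oplus(1+\sigma_*)H_0(\mathbb{Z},C(X,\mathbb{Z}))$$ and $H_n(\mathbb{Z}\rtimes\mathbb{Z}_2,C(X,\mathbb{Z}))=0$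 for $n\geq 1$. (iii) If $\alpha$ is not free, then $$H_0(\mathbb{Z}\rtimes\mathbb{Z}_2,C(X,\mathbb{Z}))\simeq(1+\sigma_*)H_0(\mathbb{Z},C(X,\mathbb{Z})),$$ and for all $n\geq 1$ $$H_{2n-1}(\mathbb{Z}\rtimes\mathbb{Z}_2,C(X,\mathbb{Z}))\simeq C(\mathrm{Fix}_\sigma\sqcup\mathrm{Fix}_{\varphi\sigma},\mathbb{Z}_2),\qquad H_{2n}(\mathbb{Z}\rtimes\mathbb{Z}_2,C(X,\mathbb{Z}))=0,$$ where $\mathrm{Fix}_a=\{x\in X: a(x)=x\}$ and $C(F,\mathbb{Z}_2)$ is the group of continuous functions from $F$ to the discrete group $\mathbb{Z}_2$. -/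

import Mathlib

open CategoryTheory

noncomputable section

namespace CantorDihedral

/-- The action of `ℤ/2` on `ℤ` (both written multiplicatively) by inversion. -/
def inversion : Multiplicative (ZMod 2) →* MulAut (Multiplicative ℤ) where
  toFun i := if i = 1 then 1 else MulEquiv.inv (Multiplicative ℤ)
  map_one' := by simp
  map_mul' i j := by
    have key : ∀ i j : Multiplicative (ZMod 2),
        (i = 1 ∧ i * j = j) ∨ (j = 1 ∧ i * j = i) ∨ (i ≠ 1 ∧ j ≠ 1 ∧ i * j = 1) := by decide
    rcases key i j with ⟨h1, h2⟩ | ⟨h1, h2⟩ | ⟨h1, h2, h3⟩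
    · rw [h2, h1]; simp
    · rw [h2, h1]; simp
    · rw [h3, if_pos rfl, if_neg h1, if_neg h2]
      ext x
      simp

/-- The group `ℤ ⋊ ℤ/2`, where `ℤ/2` acts on `ℤ` by inversion. -/
abbrev ZZ2 : Type := Multiplicative ℤ ⋊[inversion] Multiplicative (ZMod 2)

section Actions

variable {Γ X : Type} [Group Γ] [TopologicalSpace X]

/-- An action of a group by homeomorphisms is minimal if every orbit is dense. -/
def IsMinimalAction (α : Γ →* (X ≃ₜ X)) : Prop :=
  ∀ x : X, Dense (Set.range fun g : Γ => α g x)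

/-- An action is free if only the identity element has fixed points. -/
def IsFreeAction (α : Γ →* (X ≃ₜ X)) : Prop :=
  ∀ (g : Γ) (x : X), α g x = x → g = 1

/-- The `Γ`-module `C(X, ℤ)` of an action of `Γ` on `X`. The right module structure
`(f · g)(x) = f (g x)` is turned into a left one in the usual way: `(g · f)(x) = f (g⁻¹ x)`. -/
def functionRep (α : Γ →* (X ≃ₜ X)) : Rep ℤ Γ :=
  Rep.of (X := C(X, ℤ))
    { toFun := fun g =>
        { toFun := fun f => f.comp (α g⁻¹ : C(X, X))
          map_add' := fun _ _ => rfl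
          map_smul' := fun _ _ => rfl }
      map_one' := by
        ext f x
        simp
      map_mul' := fun g h => by
        ext f x
        simp }

/-- The `ℤ`-action generated by a homeomorphism. -/
def zAction (φ : X ≃ₜ X) : Multiplicative ℤ →* (X ≃ₜ X) := zpowersHom (X ≃ₜ X) φ

/-- The restriction of a homeomorphism `φ` to a set `Y` with `φ(Y) = Y`. -/
def restrictHomeo (φ : X ≃ₜ X) (Y : Set X) (hY : φ '' Y = Y) : Y ≃ₜ Y :=
  φ.subtype fun x => by
    constructor
    · intro hx
      exact hY ▸ Set.mem_image_of_mem φ hx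
    · intro hx
      change φ x ∈ Y at hx
      rw [← hY] at hx
      obtain ⟨y, hy, hyx⟩ := hx
      exact φ.injective hyx ▸ hy

end Actions

section Systems

variable {X : Type} [TopologicalSpace X]

/-- The homeomorphism `φ = α(1,0)` of an action of `ℤ ⋊ ℤ/2`. -/
def phi (α : ZZ2 →* (X ≃ₜ X)) : X ≃ₜ X :=
  α (SemidirectProduct.inl (Multiplicative.ofAdd 1))

/-- The involution `σ = α(0,1)` of an action of `ℤ ⋊ ℤ/2`. -/
def sigma (α : ZZ2 →* (X ≃ₜ X)) : X ≃ₜ X :=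
  α (SemidirectProduct.inr (Multiplicative.ofAdd 1))

theorem phi_zpow_mul_sigma (α : ZZ2 →* (X ≃ₜ X)) (n : ℤ) :
    phi α ^ n * sigma α = sigma α * phi α ^ (-n) := by
  have h : phi α * sigma α = sigma α * (phi α)⁻¹ := by
    unfold phi sigma
    rw [← map_inv, ← map_mul, ← map_mul]
    congr 1
  have h' : SemiconjBy (sigma α) (phi α)⁻¹ (phi α) := h.symm
  have := h'.zpow_right n
  rw [inv_zpow'] at this
  exact this.eq.symm

/-- The `n`-th homology group of `ℤ ⋊ ℤ/2` with coefficients in `C(X, ℤ)`. -/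
abbrev homZZ2 (α : ZZ2 →* (X ≃ₜ X)) (n : ℕ) : ModuleCat ℤ :=
  groupHomology (functionRep α) n

/-- The `n`-th homology group of `ℤ` with coefficients in `C(X, ℤ)`, for the `ℤ`-action generated
by `φ`. -/
abbrev homZ (φ : X ≃ₜ X) (n : ℕ) : ModuleCat ℤ :=
  groupHomology (functionRep (zAction φ)) n

/-- The map `f ↦ f ∘ σ` on `C(X, ℤ)`, as a morphism of `ℤ`-modules over the inversion of `ℤ`. -/
def sigmaPullback (α : ZZ2 →* (X ≃ₜ X)) :
    functionRep (zAction (phi α)) ⟶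
      Rep.res (MulEquiv.inv (Multiplicative ℤ)).toMonoidHom
        (functionRep (zAction (phi α))) :=
  Rep.ofHom
    { toFun := fun f : C(X, ℤ) => f.comp (sigma α : C(X, X))
      map_add' := fun _ _ => rfl
      map_smul' := fun _ _ => rfl
      isIntertwining' := fun g => by
        refine LinearMap.ext fun f => ContinuousMap.ext fun x => ?_
        have h : zAction (phi α) g⁻¹ * sigma α = sigma α * zAction (phi α) g⁻¹⁻¹ := by
          simpa [zAction] using phi_zpow_mul_sigma α (-(g.toAdd))
        exact congrArg (f : C(X, ℤ)) (DFunLike.congr_fun h x) }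

/-- The endomorphism `σ_*` of `H_n(ℤ, C(X, ℤ))` induced by `σ`. -/
def sigmaStar (α : ZZ2 →* (X ≃ₜ X)) (n : ℕ) : homZ (phi α) n →+ homZ (phi α) n :=
  (groupHomology.map (MulEquiv.inv (Multiplicative ℤ)).toMonoidHom
    (sigmaPullback α) n).hom.toAddMonoidHom

/-- The subgroup `(1 + σ_*) H_0(ℤ, C(X, ℤ))` of `H_0(ℤ, C(X, ℤ))`. -/
def onePlusSigma (α : ZZ2 →* (X ≃ₜ X)) : AddSubgroup (homZ (phi α) 0) :=
  (AddMonoidHom.id (homZ (phi α) 0) + sigmaStar α 0).range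

end Systems

end CantorDihedral

end

open CantorDihedral

/-! The group is infinite dihedral, the free product of the order-two groups generated by `s₁ = σ`
and `s₂ = φσ`. So `ℤ` has a free resolution with one generator in degree 0 and two in every higher
degree, the `i`-th generator of degree `n` going to `sᵢ + (-1)ⁿ` (`exact_resAug`, `exact_resD`).
Chains with coefficients in `C(X, ℤ)` become pairs of functions, and above degree one the homology
splits into that of two single involutions.

For one involution `s` of the Cantor set, a clopen invariant set without fixed points has a clopen
fundamental domain. Hence every anti-invariant function is `g - g ∘ s`, which kills even degrees,
and an invariant function is `g + g ∘ s` exactly when it is even on the fixed points, which gives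
`C(Fix, ℤ/2)` in odd degrees. In degree one the cycle condition only couples the two components: the
defect `f₁ ∘ σ - f₁` is `φ`-invariant and changes sign under `σ`. It vanishes if `φ` is minimal;
otherwise `X = Y ⊔ σ(Y)` with `φ` minimal on `Y`, and the constant value of the defect on `Y` yields
`ℤ`.

In degree zero, compare `[f]` with `[f + f ∘ σ]`. If `f + f ∘ σ = g - g ∘ φ`, then `g + g ∘ φσ` is a
constant `c`, and `[f] = 0` as soon as `c` is even. A fixed point of `σ` or `φσ` forces `c` to be
even. If the action is free and `φ` is minimal, the parity of `c` is a genuine obstruction; it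
produces the summand `ℤ/2`, which splits off because `(1 + σ_*) H₀` has no two-torsion. If `φ` is
not minimal, restricting `f + f ∘ σ` to `Y` identifies `H₀` with that of `φ` on `Y`. -/

open CategoryTheory

noncomputable section

namespace CantorDihedral

/-! ### A free resolution of `ℤ` over the infinite dihedral group -/

section Resolution

open MonoidAlgebra

/-- The two reflections `σ` and `φσ` generating `ℤ ⋊ ℤ/2`. -/
def refl : Bool → ZZ2
  | true => SemidirectProduct.inr (Multiplicative.ofAdd 1)
  | false => SemidirectProduct.inl (Multiplicative.ofAdd 1) *
      SemidirectProduct.inr (Multiplicative.ofAdd 1)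

theorem refl_mul_self (i : Bool) : refl i * refl i = 1 := by
  cases i <;> rfl

theorem refl_inv (i : Bool) : (refl i)⁻¹ = refl i :=
  inv_eq_of_mul_eq_one_left (refl_mul_self i)

theorem refl_right (i : Bool) : (refl i).right = Multiplicative.ofAdd 1 := by
  cases i <;> rfl

theorem right_mul_refl (g : ZZ2) (i : Bool) : (g * refl i).right = 1 ↔ g.right ≠ 1 := by
  rw [SemidirectProduct.mul_right, refl_right]
  generalize g.right = x
  revert x
  decide

theorem refl_mul_refl :
    refl false * refl true = SemidirectProduct.inl (Multiplicative.ofAdd 1) := by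
  rfl

theorem closure_phi_sigma : Subgroup.closure
    {(SemidirectProduct.inl (Multiplicative.ofAdd 1) : ZZ2),
      SemidirectProduct.inr (Multiplicative.ofAdd 1)} = ⊤ := by
  rw [eq_top_iff]
  rintro g -
  rw [← SemidirectProduct.inl_left_mul_inr_right g]
  refine mul_mem ?_ ?_
  · have : g.left = Multiplicative.ofAdd (1 : ℤ) ^ (g.left.toAdd) := by
      rw [← ofAdd_zsmul]; simp
    rw [this, map_zpow]
    exact zpow_mem (Subgroup.subset_closure (by simp)) _
  · have : ∀ x : Multiplicative (ZMod 2), x = 1 ∨ x = Multiplicative.ofAdd 1 := by decide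
    rcases this g.right with h | h
    · rw [h, MonoidHom.map_one]; exact one_mem _
    · rw [h]; exact Subgroup.subset_closure (by simp)

theorem closure_refl : Subgroup.closure (Set.range refl) = ⊤ := by
  rw [eq_top_iff, ← closure_phi_sigma, Subgroup.closure_le]
  have h := fun i => Subgroup.subset_closure (Set.mem_range_self (f := refl) i)
  rintro _ (rfl | rfl)
  · rw [← refl_mul_refl]; exact mul_mem (h _) (h _)
  · exact h true

theorem coeff_mul_single_group {G : Type*} [Group G] (x : MonoidAlgebra ℤ G) (g h : G) (r : ℤ) :
    (x * single g r).coeff h = x.coeff (h * g⁻¹) * r :=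
  coeff_mul_single_eq_coeff_mul _ fun _ _ => eq_mul_inv_iff_mul_eq.symm

/-- If `x s = ε x` for a reflection `s` and a sign `ε`, then `x` is a left multiple of `1 + ε s`. -/
theorem exists_eq_mul_refl (x : MonoidAlgebra ℤ ZZ2) (i : Bool) (e : ℤ) (he : e * e = 1)
    (h : x * (single (refl i) 1 + single 1 (-e)) = 0) :
    ∃ y : MonoidAlgebra ℤ ZZ2, x = y * (single (refl i) 1 + single 1 e) := by
  have h' : ∀ g, x.coeff (g * refl i) = e * x.coeff g := fun g => by
    have := congrArg (fun z => z.coeff g) h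
    simp only [mul_add, coeff_add, Finsupp.add_apply, coeff_mul_single_group, refl_inv,
      coeff_zero, Finsupp.coe_zero, Pi.zero_apply, inv_one, mul_one] at this
    linarith
  -- Right multiplication by a reflection flips the `ZMod 2` component, so these elements form a
  -- transversal of the left cosets of `{1, refl i}`, and a quotient `y` can be supported on them.
  let p : ZZ2 → Prop := fun g => g.right = 1
  refine ⟨⟨(e • x.coeff).filter p⟩, ?_⟩
  ext g
  simp only [mul_add, coeff_add, Finsupp.add_apply, coeff_mul_single_group, refl_inv,
    inv_one, mul_one]
  by_cases hg : g.right = 1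
  · have : ¬ p (g * refl i) := by simp [p, right_mul_refl, hg]
    rw [Finsupp.filter_apply_neg _ _ this, Finsupp.filter_apply_pos p _ hg]
    simp
    linear_combination (-x.coeff g) * he
  · have : p (g * refl i) := (right_mul_refl _ _).2 hg
    rw [Finsupp.filter_apply_pos _ _ this, Finsupp.filter_apply_neg p _ hg]
    simp [h']
    linear_combination (-x.coeff g) * he

/-- Two sign changes cancel, so `x` is invariant under right translation by `φ`, the product of the
reflections. As `φ` has infinite order, finite support leaves only `x = 0`. -/
theorem eq_zero_of_mul_eq (x : MonoidAlgebra ℤ ZZ2)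
    (h : ∀ i, x * single (refl i) 1 = -x) : x = 0 := by
  have h1 : ∀ i g, x.coeff (g * refl i) = - x.coeff g := fun i g => by
    have := congrArg (fun z => z.coeff g) (h i)
    simpa [coeff_mul_single_group, refl_inv] using this
  have h2 : ∀ g, x.coeff (g * SemidirectProduct.inl (Multiplicative.ofAdd 1)) = x.coeff g :=
    fun g => by rw [← refl_mul_refl, ← mul_assoc, h1, h1, neg_neg]
  have h3 : ∀ (n : ℕ) g,
      x.coeff (g * SemidirectProduct.inl (Multiplicative.ofAdd (n : ℤ))) = x.coeff g := by
    intro n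
    induction n with
    | zero => intro g; simp
    | succ n ih =>
      intro g
      rw [Nat.cast_succ, ofAdd_add, MonoidHom.map_mul, ← mul_assoc, h2, ih]
  ext g
  by_contra hg
  have : Function.Injective
      fun n : ℕ => g * SemidirectProduct.inl (φ := inversion) (Multiplicative.ofAdd (n : ℤ)) := by
    intro m n hmn
    simpa using hmn
  refine Set.infinite_range_of_injective this (x.coeff.hasFiniteSupport.subset ?_)
  rintro _ ⟨n, rfl⟩
  simpa [h3] using hg

/-- The identities `gh - 1 = g(h - 1) + (g - 1)` and `g⁻¹ - 1 = -g⁻¹(g - 1)` show that the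
augmentation ideal is generated, as a left ideal, by `s - 1` for `s` in a generating set. -/
theorem exists_sum_of_augmentation (x : MonoidAlgebra ℤ ZZ2)
    (hx : x.coeff.sum (fun _ r => r) = 0) :
    ∃ y : Bool → MonoidAlgebra ℤ ZZ2, x = ∑ i, y i * (single (refl i) 1 + single 1 (-1)) := by
  let I : Submodule (MonoidAlgebra ℤ ZZ2) (MonoidAlgebra ℤ ZZ2) :=
    Submodule.span _ (Set.range fun i => single (refl i) 1 + single 1 (-1))
  have key : ∀ g : ZZ2, single g (1 : ℤ) - 1 ∈ I := by
    intro g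
    have hg : g ∈ Subgroup.closure (Set.range refl) := by rw [closure_refl]; trivial
    induction hg using Subgroup.closure_induction with
    | mem g hg =>
      obtain ⟨i, rfl⟩ := hg
      have : single (refl i) (1 : ℤ) - 1 = single (refl i) 1 + single 1 (-1) := by
        rw [single_neg, sub_eq_add_neg]; rfl
      rw [this]
      exact Submodule.subset_span (Set.mem_range_self i)
    | one => simp [one_def]
    | mul g h _ _ hg hh =>
      have : single (g * h) (1 : ℤ) - 1 = single g (1 : ℤ) • (single h (1 : ℤ) - 1)
          + (single g (1 : ℤ) - 1) := by
        simp [mul_sub, single_mul_single]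
      rw [this]
      exact add_mem (Submodule.smul_mem _ _ hh) hg
    | inv g _ hg =>
      have : single g⁻¹ (1 : ℤ) - 1 = - (single g⁻¹ (1 : ℤ) • (single g (1 : ℤ) - 1)) := by
        simp [mul_sub, single_mul_single, one_def]
      rw [this]
      exact neg_mem (Submodule.smul_mem _ _ hg)
  have hxI : x ∈ I := by
    have : x = x.coeff.sum fun g r => single (1 : ZZ2) r * (single g (1 : ℤ) - 1) := by
      simp only [mul_sub, single_mul_single, one_mul, mul_one, Finsupp.sum_sub]
      have : (x.coeff.sum fun (g : ZZ2) r => single (1 : ZZ2) r) = 0 := by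
        have := congrArg (single (1 : ZZ2)) hx
        rw [single_zero] at this
        rw [← this]
        exact (map_finsuppSum (singleAddHom (1 : ZZ2)) x.coeff fun _ r => r).symm
      rw [this, sub_zero]
      exact (sum_coeff_single x).symm
    rw [this]
    exact Submodule.finsuppSum_mem _ _ _ _ fun g _ => Submodule.smul_mem _ _ (key g)
  obtain ⟨c, hc⟩ := (Submodule.mem_span_range_iff_exists_fun _).1 hxI
  exact ⟨c, hc.symm⟩

/-- Index types for the free modules in the resolution of `ℤ` over `ℤ ⋊ ℤ/2`. -/
abbrev gens : ℕ → Type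
  | 0 => Unit
  | _ + 1 => Bool

instance instDecidableEqGens (n : ℕ) : DecidableEq (gens n) := by
  cases n
  · exact inferInstanceAs (DecidableEq Unit)
  · exact inferInstanceAs (DecidableEq Bool)

/-- The generator of the `n`-th module of the resolution hit by the `i`-th generator. -/
abbrev target : ∀ n : ℕ, Bool → gens n
  | 0, _ => ()
  | _ + 1, i => i

/-- The differential of the resolution, mapping the `i`-th generator to `sᵢ + (-1)ⁿ⁺¹`. -/
def resD (n : ℕ) : Rep.free ℤ ZZ2 Bool ⟶ Rep.free ℤ ZZ2 (gens n) :=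
  Rep.freeLift ℤ ZZ2 _ fun i =>
    Finsupp.single (target n i) (single (refl i) 1 + single 1 ((-1) ^ (n + 1)))

theorem resD_single (n : ℕ) (i : Bool) (x : MonoidAlgebra ℤ ZZ2) :
    (resD n).hom (Finsupp.single i x) =
      Finsupp.single (target n i) (x * (single (refl i) 1 + single 1 ((-1) ^ (n + 1)))) := by
  induction x using MonoidAlgebra.induction_linear with
  | zero => simp
  | add x y hx hy => rw [Finsupp.single_add, map_add, hx, hy, add_mul, Finsupp.single_add]
  | single g r =>
    rw [resD, Rep.hom_ofHom, Representation.freeLift_single_single, mul_add, single_mul_single,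
      single_mul_single]
    simp

theorem resD_apply (n : ℕ) (x : Bool →₀ MonoidAlgebra ℤ ZZ2) :
    (resD n).hom x = ∑ i, Finsupp.single (target n i)
      (x i * (single (refl i) 1 + single 1 ((-1) ^ (n + 1)))) := by
  conv_lhs => rw [← Finsupp.univ_sum_single x]
  rw [map_sum]
  exact Finset.sum_congr rfl fun i _ => resD_single n i (x i)

/-- The augmentation `ℤ[ℤ ⋊ ℤ/2] → ℤ`. -/
def resAug : Rep.free ℤ ZZ2 Unit ⟶ Rep.trivial ℤ ZZ2 ℤ :=
  Rep.freeLift ℤ ZZ2 _ fun _ => (1 : ℤ)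

theorem resAug_single (x : MonoidAlgebra ℤ ZZ2) :
    (resAug).hom (Finsupp.single () x) = x.coeff.sum fun _ r => r := by
  induction x using MonoidAlgebra.induction_linear with
  | zero => simp
  | add x y hx hy =>
    rw [Finsupp.single_add, map_add, hx, hy]
    exact (Finsupp.sum_add_index' (fun _ => rfl) fun _ _ _ => rfl).symm
  | single g r =>
    rw [resAug, Rep.hom_ofHom, Representation.freeLift_single_single]
    simp

theorem refl_add_mul (i : Bool) (e : ℤ) (he : e * e = 1) :
    (single (refl i) (1 : ℤ) + single 1 e) * (single (refl i) 1 + single 1 (-e)) = 0 := by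
  simp only [mul_add, add_mul, single_mul_single, refl_mul_self, one_mul, mul_one, mul_neg, he]
  rw [single_neg, single_neg]
  abel

theorem resD_comp (n : ℕ) : resD (n + 1) ≫ resD n = 0 := by
  refine Rep.free_ext _ _ _ _ _ fun i => ?_
  have := refl_add_mul i ((-1) ^ (n + 2)) (by rw [← mul_pow]; simp)
  rw [Rep.hom_comp, Representation.IntertwiningMap.comp_apply, resD_single, resD_single, mul_assoc,
    show (-1 : ℤ) ^ (n + 1) = - (-1) ^ (n + 2) by ring, this, mul_zero, Finsupp.single_zero]
  rfl

theorem resD_comp_resAug : resD 0 ≫ resAug = 0 := by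
  refine Rep.free_ext _ _ _ _ _ fun i => ?_
  rw [Rep.hom_comp, Representation.IntertwiningMap.comp_apply, resD_single, resAug_single,
    ← one_def, one_mul, coeff_add, Finsupp.sum_add_index' (fun _ => rfl) fun _ _ _ => rfl,
    coeff_single, coeff_single, Finsupp.sum_single_index rfl, Finsupp.sum_single_index rfl]
  rfl

theorem exact_resD (n : ℕ) : Function.Exact (resD (n + 1)).hom (resD n).hom := by
  intro x
  constructor
  · intro hx
    rw [resD_apply] at hx
    suffices h : ∀ i, x i * (single (refl i) 1 + single 1 ((-1) ^ (n + 1))) = 0 by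
      choose y hy using fun i => exists_eq_mul_refl (x i) i ((-1) ^ (n + 2)) (by
        rw [← mul_pow]; simp) (by
          rw [show - (-1 : ℤ) ^ (n + 2) = (-1) ^ (n + 1) by ring]; exact h i)
      refine ⟨Finsupp.equivFunOnFinite.symm y, ?_⟩
      rw [resD_apply]
      refine Eq.trans ?_ (Finsupp.univ_sum_single x)
      exact Finset.sum_congr rfl fun i _ => congrArg (Finsupp.single i) (hy i).symm
    rw [Fintype.sum_bool] at hx
    cases n with
    | zero =>
      rw [← Finsupp.single_add, Finsupp.single_eq_zero] at hx
      -- Here only the sum of the two terms is known to vanish. Each term is thus the negative of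
      -- the other, so it changes sign under both reflections and must be zero.
      have hz : x true * (single (refl true) 1 + single 1 ((-1) ^ (0 + 1))) = 0 := by
        refine eq_zero_of_mul_eq _ fun i => ?_
        have h2 : ∀ i, (single (refl i) (1 : ℤ) + single 1 ((-1) ^ (0 + 1))) *
            single (refl i) 1 = - (single (refl i) 1 + single 1 ((-1) ^ (0 + 1))) := by
          intro i
          simp [add_mul, single_mul_single, refl_mul_self, single_neg, add_comm]
        cases i with
        | true => rw [mul_assoc, h2, mul_neg]
        | false =>
          rw [eq_neg_of_add_eq_zero_left hx, neg_mul, mul_assoc, h2, mul_neg]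
      rw [hz, zero_add] at hx
      rintro (_ | _)
      · exact hx
      · exact hz
    | succ n =>
      rintro (_ | _)
      · simpa using congrArg (fun f => f false) hx
      · simpa using congrArg (fun f => f true) hx
  · rintro ⟨y, rfl⟩
    exact congrArg (fun f => f.hom y) (resD_comp n)

theorem exact_resAug : Function.Exact (resD 0).hom resAug.hom := by
  intro x
  constructor
  · intro hx
    have hx' : x = Finsupp.single () (x ()) := Finsupp.ext fun _ => by simp
    rw [hx', resAug_single] at hx
    obtain ⟨y, hy⟩ := exists_sum_of_augmentation _ hx
    refine ⟨Finsupp.equivFunOnFinite.symm y, ?_⟩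
    rw [resD_apply, hx', hy]
    exact (map_sum (Finsupp.singleAddHom ()) _ _).symm
  · rintro ⟨y, rfl⟩
    exact congrArg (fun f => f.hom y) resD_comp_resAug

/-- The modules of the free resolution of `ℤ` over `ℤ ⋊ ℤ/2`. -/
abbrev resX (n : ℕ) : Rep ℤ ZZ2 := Rep.free ℤ ZZ2 (gens n)

/-- The differentials of the free resolution of `ℤ` over `ℤ ⋊ ℤ/2`. -/
abbrev resd (n : ℕ) : resX (n + 1) ⟶ resX n := resD n

/-- The free resolution of `ℤ` over `ℤ ⋊ ℤ/2`. -/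
def resComplex : ChainComplex (Rep ℤ ZZ2) ℕ :=
  ChainComplex.of resX resd resD_comp

theorem resComplex_d (n : ℕ) : resComplex.d (n + 1) n = resD n :=
  ChainComplex.of_d resX resd n

/-- The augmentation of the free resolution of `ℤ` over `ℤ ⋊ ℤ/2`. -/
def resπ : resComplex ⟶ (ChainComplex.single₀ (Rep ℤ ZZ2)).obj (Rep.trivial ℤ ZZ2 ℤ) :=
  (resComplex.toSingle₀Equiv _).symm
    ⟨resAug, (congrArg (· ≫ resAug) (resComplex_d 0)).trans resD_comp_resAug⟩

theorem exact_of_function_exact {k G : Type} [CommRing k] [Group G] {A B C : Rep.{0} k G}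
    {f f' : A ⟶ B} {g g' : B ⟶ C} (w : f ≫ g = 0)
    (hf : f = f') (hg : g = g') (h : Function.Exact f'.hom g'.hom) :
    (ShortComplex.mk f g w).Exact := by
  subst hf hg
  apply (forget₂ (Rep.{0} k G) (ModuleCat.{0} k)).reflects_exact_of_faithful
  rw [ShortComplex.moduleCat_exact_iff_range_eq_ker]
  exact (LinearMap.exact_iff (f := f.hom.toLinearMap) (g := g.hom.toLinearMap).1 h).symm

theorem quasiIso_resπ : QuasiIso resπ where
  quasiIsoAt m := by
    cases m with
    | zero =>
      rw [ChainComplex.quasiIsoAt₀_iff, ShortComplex.quasiIso_iff_of_zeros' _ rfl rfl rfl]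
      constructor
      · exact exact_of_function_exact _ (resComplex_d 0) (f' := resD 0) (g' := resAug)
          (ChainComplex.toSingle₀Equiv_symm_apply_f_zero _ _) exact_resAug
      · refine (Rep.epi_iff_surjective (A := Rep.free ℤ ZZ2 Unit) (B := Rep.trivial ℤ ZZ2 ℤ)
          resAug).2 fun x => ⟨Finsupp.single () (single 1 x), ?_⟩
        rw [resAug_single]
        simp
    | succ m =>
      rw [quasiIsoAt_iff_exactAt' (hL := ChainComplex.exactAt_succ_single_obj ..),
          HomologicalComplex.exactAt_iff' _ (m + 2) (m + 1) m (by simp) (by simp)]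
      exact exact_of_function_exact _ (resComplex_d (m + 1)) (resComplex_d m) (exact_resD m)

/-- The free resolution of `ℤ` as a projective resolution. -/
def resolution : ProjectiveResolution (Rep.trivial ℤ ZZ2 ℤ) where
  complex := resComplex
  projective n := inferInstanceAs (Projective (Rep.free ℤ ZZ2 (gens n)))
  π := resπ
  quasiIso := quasiIso_resπ

/-! ### Group homology computed from the resolution -/

theorem nonempty_addEquiv_of_surjective {C H B : Type*} [AddCommGroup C] [AddCommGroup H]
    [AddCommGroup B] (p : C →+ H) (q : C →+ B) (hp : Function.Surjective p)
    (hq : Function.Surjective q) (h : ∀ x, p x = 0 ↔ q x = 0) : Nonempty (H ≃+ B) :=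
  ⟨(QuotientAddGroup.quotientKerEquivOfSurjective p hp).symm.trans
    ((QuotientAddGroup.quotientAddEquivOfEq (AddSubgroup.ext h)).trans
      (QuotientAddGroup.quotientKerEquivOfSurjective q hq))⟩

/-- A short complex of modules has homology `B` if there is a surjection from the cycles to `B`
whose kernel consists of the boundaries. -/
theorem nonempty_homology_addEquiv {k : Type} [CommRing k] (S : ShortComplex (ModuleCat.{0} k))
    {M B : Type*} [AddCommGroup M] [AddCommGroup B] (e : S.X₂ ≃+ M) (Z : AddSubgroup M)
    (hZ : ∀ x, S.g x = 0 ↔ e x ∈ Z) (F : Z →+ B) (hF : Function.Surjective F)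
    (hF0 : ∀ z, F z = 0 ↔ ∃ y, e (S.f y) = z) : Nonempty (S.homology ≃+ B) := by
  let i := S.moduleCatHomologyIso.toLinearEquiv.toAddEquiv
  let p : LinearMap.ker S.g.hom →+ S.moduleCatLeftHomologyData.H :=
    (Submodule.mkQ (LinearMap.range S.moduleCatToCycles)).toAddMonoidHom
  let j : LinearMap.ker S.g.hom →+ Z :=
    (e.toAddMonoidHom.comp (LinearMap.ker S.g.hom).subtype.toAddMonoidHom).codRestrict Z
      fun x => (hZ x).1 x.2
  obtain ⟨E⟩ := nonempty_addEquiv_of_surjective p (F.comp j)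
    (Submodule.mkQ_surjective _) (hF.comp (by
      rintro ⟨z, hz⟩
      exact ⟨⟨e.symm z, (hZ _).2 (by simpa using hz)⟩, Subtype.ext (e.apply_symm_apply z)⟩))
    (by
      intro x
      refine (Submodule.Quotient.mk_eq_zero _).trans ?_
      refine Iff.trans ?_ (hF0 (j x)).symm
      refine exists_congr fun y => ?_
      rw [Subtype.ext_iff]
      exact e.injective.eq_iff.symm)
  exact ⟨i.trans E⟩

section FreeTensor

variable {k G : Type} [CommRing k] [Group G] (A : Rep.{0} k G) {α : Type} [DecidableEq α]

variable (α) in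
/-- The additive equivalence `(A ⊗ (α →₀ k[G]))_G ≃ (α →₀ A)`. -/
def coinvariantsTensorFreeAddEquiv :
    ((Rep.coinvariantsTensor k G).obj A).obj (Rep.free k G α) ≃+ (α →₀ A) :=
  (Rep.coinvariantsTensorFreeLEquiv A α).toAddEquiv

theorem coinvariantsTensorFreeAddEquiv_mk (a : A) (j : α) (g : G) (r : k) :
    coinvariantsTensorFreeAddEquiv A α
      (Rep.coinvariantsTensorMk A (Rep.free k G α) a (Finsupp.single j (single g r))) =
      Finsupp.single j (r • A.ρ g⁻¹ a) :=
  Rep.coinvariantsTensorFreeToFinsupp_mk_tmul_single A a j g r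

theorem coinvariantsTensorFreeAddEquiv_symm_single (i : α) (a : A) :
    (coinvariantsTensorFreeAddEquiv A α).symm (Finsupp.single i a) =
      Rep.coinvariantsTensorMk A (Rep.free k G α) a (Finsupp.single i (single 1 1)) :=
  Rep.finsuppToCoinvariantsTensorFree_single (A := A) i a

end FreeTensor

variable (A : Rep ℤ ZZ2)

/-- The complex `A ⊗ P` computing the homology of `A`, for the free resolution `P` of `ℤ`. -/
abbrev tensorComplex : ChainComplex (ModuleCat ℤ) ℕ :=
  resolution.complex.coinvariantsTensorObj A

/-- The identification of the `n`-th term of `A ⊗ P` with a power of `A`. -/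
def tensorEquiv (n : ℕ) : (tensorComplex A).X n ≃+ (gens n →₀ A) :=
  coinvariantsTensorFreeAddEquiv A (gens n)

/-- The differential of `A ⊗ P`. -/
def chainD (n : ℕ) : (Bool →₀ A) →+ (gens n →₀ A) :=
  Finsupp.liftAddHom fun i => (Finsupp.singleAddHom (target n i)).comp
    ((A.ρ (refl i)).toAddMonoidHom + (-1 : ℤ) ^ (n + 1) • AddMonoidHom.id A)

theorem chainD_single (n : ℕ) (i : Bool) (a : A) :
    chainD A n (Finsupp.single i a) =
      Finsupp.single (target n i) (A.ρ (refl i) a + (-1 : ℤ) ^ (n + 1) • a) := by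
  simp [chainD]

/-- In the coinvariants `a ⊗ g` becomes `g⁻¹ a`; reflections are their own inverses, so no inverse
shows up in `chainD`. -/
theorem tensorEquiv_d (n : ℕ) (x : (tensorComplex A).X (n + 1)) :
    tensorEquiv A n ((tensorComplex A).d (n + 1) n x) = chainD A n (tensorEquiv A (n + 1) x) := by
  obtain ⟨x, rfl⟩ := (tensorEquiv A (n + 1)).symm.surjective x
  rw [AddEquiv.apply_symm_apply]
  induction x using Finsupp.induction_linear with
  | zero => simp
  | add x y hx hy => simp only [map_add, hx, hy]
  | single i a =>
    have h1 : (tensorEquiv A (n + 1)).symm (Finsupp.single i a) =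
        Rep.coinvariantsTensorMk A (resX (n + 1)) a (Finsupp.single i (single 1 1)) :=
      coinvariantsTensorFreeAddEquiv_symm_single A i a
    have h2 : (tensorComplex A).d (n + 1) n
        (Rep.coinvariantsTensorMk A (resX (n + 1)) a (Finsupp.single i (single 1 1))) =
        Rep.coinvariantsTensorMk A (resX n) a
          ((resD n).hom (Finsupp.single i (single 1 1))) := by
      rw [← resComplex_d]
      rfl
    have h3 : ∀ (j : gens n) (g : ZZ2) (r : ℤ), tensorEquiv A n
        (Rep.coinvariantsTensorMk A (resX n) a (Finsupp.single j (single g r))) =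
        Finsupp.single j (r • A.ρ g⁻¹ a) := fun j g r =>
      (coinvariantsTensorFreeAddEquiv_mk A a j g r).trans
        (congrArg (Finsupp.single j) (int_smul_eq_zsmul A.hV2 r _))
    rw [h1, h2, resD_single, chainD_single, ← one_def, one_mul, Finsupp.single_add, map_add]
    refine (map_add (tensorEquiv A n) _ _).trans ?_
    rw [h3, h3, refl_inv, ← Finsupp.single_add]
    simp

theorem nonempty_groupHomology_addEquiv (n : ℕ) {B : Type*} [AddCommGroup B]
    (F : (chainD A n).ker →+ B) (hF : Function.Surjective F)
    (hF0 : ∀ z, F z = 0 ↔ ∃ y, chainD A (n + 1) y = z) :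
    Nonempty (groupHomology A (n + 1) ≃+ B) := by
  let K := tensorComplex A
  have hZ : ∀ x : K.X (n + 1), K.d (n + 1) n x = 0 ↔
      tensorEquiv A (n + 1) x ∈ (chainD A n).ker := fun x => by
    rw [AddMonoidHom.mem_ker, ← tensorEquiv_d]
    exact (map_eq_zero_iff _ (tensorEquiv A n).injective).symm
  have hB : ∀ z, F z = 0 ↔ ∃ y, tensorEquiv A (n + 1) (K.d (n + 2) (n + 1) y) = z := fun z => by
    rw [hF0, (tensorEquiv A (n + 2)).surjective.exists]
    exact exists_congr fun y => by rw [tensorEquiv_d]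
  obtain ⟨E⟩ := nonempty_homology_addEquiv (K.sc' (n + 2) (n + 1) n) (tensorEquiv A (n + 1))
    (chainD A n).ker hZ F hF hB
  let i := groupHomologyIso A (n + 1) resolution ≪≫
    ShortComplex.homologyMapIso (K.isoSc' (n + 2) (n + 1) n (by simp) (by simp))
  exact ⟨i.toLinearEquiv.toAddEquiv.trans E⟩

end Resolution

/-! ### Coinvariants and zeroth homology -/

section Coinvariants

/-- Telescoping: `gh - 1 = (g - 1)h + (h - 1)` and `g⁻¹ - 1 = -(g - 1)g⁻¹`. The subgroup `N` need
not be invariant, since the hypothesis covers every vector. -/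
theorem rho_sub_mem_of_closure {k G V : Type*} [CommRing k] [Group G] [AddCommGroup V] [Module k V]
    (ρ : Representation k G V) (N : AddSubgroup V) {S : Set G} (hS : Subgroup.closure S = ⊤)
    (h : ∀ s ∈ S, ∀ v, ρ s v - v ∈ N) (g : G) (v : V) : ρ g v - v ∈ N := by
  have hg : g ∈ Subgroup.closure S := by rw [hS]; trivial
  induction hg using Subgroup.closure_induction generalizing v with
  | mem g hg => exact h g hg v
  | one => simp
  | mul g h _ _ hg hh =>
    have : ρ (g * h) v - v = (ρ g (ρ h v) - ρ h v) + (ρ h v - v) := by simp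
    rw [this]
    exact add_mem (hg _) (hh _)
  | inv g _ hg =>
    have := neg_mem (hg (ρ g⁻¹ v))
    simpa using this

theorem H0π_surjective {k G : Type} [CommRing k] [Group G] (A : Rep.{0} k G) :
    Function.Surjective (groupHomology.H0π A) :=
  (ModuleCat.epi_iff_surjective _).1 inferInstance

theorem H0π_eq_zero_iff {k G : Type} [CommRing k] [Group G] (A : Rep.{0} k G) (x : A) :
    groupHomology.H0π A x = 0 ↔ x ∈ Representation.Coinvariants.ker A.ρ := by
  rw [← Representation.Coinvariants.mk_eq_zero]
  have h := groupHomology.H0π_comp_H0Iso_hom_apply A x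
  constructor
  · intro hx
    rw [hx, map_zero] at h
    exact h.symm
  · intro hx
    have h' : (groupHomology.H0Iso A).hom (groupHomology.H0π A x) = 0 := h.trans hx
    have := congrArg (groupHomology.H0Iso A).inv h'
    simpa using this

end Coinvariants

section ToH0

variable {X : Type} [TopologicalSpace X]

/-- The quotient map from `C(X, ℤ)` onto the zeroth homology of an action. -/
def toH0 {Γ : Type} [Group Γ] (α : Γ →* (X ≃ₜ X)) :
    C(X, ℤ) →+ groupHomology (functionRep α) 0 :=
  (groupHomology.H0π (functionRep α)).hom.toAddMonoidHom

theorem toH0_surjective {Γ : Type} [Group Γ] (α : Γ →* (X ≃ₜ X)) :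
    Function.Surjective (toH0 α) :=
  H0π_surjective (functionRep α)

theorem toH0_eq_zero_iff {Γ : Type} [Group Γ] (α : Γ →* (X ≃ₜ X)) (f : C(X, ℤ)) :
    toH0 α f = 0 ↔ f ∈ Representation.Coinvariants.ker (functionRep α).ρ :=
  H0π_eq_zero_iff (functionRep α) f

theorem toH0_comp {Γ : Type} [Group Γ] (α : Γ →* (X ≃ₜ X)) (g : Γ) (f : C(X, ℤ)) :
    toH0 α (f.comp (α g : C(X, X))) = toH0 α f := by
  rw [← sub_eq_zero, ← map_sub, toH0_eq_zero_iff]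
  refine Representation.Coinvariants.mem_ker_of_eq g⁻¹ f _ ?_
  change f.comp (α g⁻¹⁻¹ : C(X, X)) - f = _
  rw [inv_inv]

/-- A subgroup of `C(X, ℤ)` containing `f ∘ s - f` for all `s` in a generating set contains the
kernel of the quotient map onto the zeroth homology. -/
theorem mem_of_toH0_eq_zero {Γ : Type} [Group Γ] (α : Γ →* (X ≃ₜ X)) (N : AddSubgroup C(X, ℤ))
    {S : Set Γ} (hS : Subgroup.closure S = ⊤)
    (h : ∀ s ∈ S, ∀ f : C(X, ℤ), f.comp (α s : C(X, X)) - f ∈ N) {f : C(X, ℤ)}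
    (hf : toH0 α f = 0) : f ∈ N := by
  rw [toH0_eq_zero_iff] at hf
  refine (Submodule.span_le (p := AddSubgroup.toIntSubmodule N)).2 ?_ hf
  rintro _ ⟨⟨g, w⟩, rfl⟩
  refine rho_sub_mem_of_closure (functionRep α).ρ N hS (fun s hs v => ?_) g w
  let v' : C(X, ℤ) := v
  have h' := neg_mem (h s hs (v'.comp (α s⁻¹ : C(X, X))))
  have : (v'.comp (α s⁻¹ : C(X, X))).comp (α s : C(X, X)) = v' := by
    ext x
    simp
  rw [this, neg_sub] at h'
  exact h'

theorem toH0_zAction_eq_zero_iff (φ : X ≃ₜ X) (f : C(X, ℤ)) :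
    toH0 (zAction φ) f = 0 ↔ ∃ g : C(X, ℤ), ∀ x, f x = g x - g (φ x) := by
  have h1 : zAction φ (Multiplicative.ofAdd 1) = φ := by simp [zAction]
  constructor
  · intro hf
    let N : AddSubgroup C(X, ℤ) := (AddMonoidHom.mk'
      (fun g : C(X, ℤ) => g - g.comp (φ : C(X, X))) fun a b => by
        ext x; simp; ring).range
    obtain ⟨g, hg⟩ := mem_of_toH0_eq_zero (zAction φ) N (S := {Multiplicative.ofAdd 1})
      (by
        rw [eq_top_iff]
        rintro g -
        rw [← Subgroup.zpowers_eq_closure, Subgroup.mem_zpowers_iff]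
        exact ⟨g.toAdd, by rw [← ofAdd_zsmul]; simp⟩)
      (by
        rintro _ rfl f
        refine ⟨-f, ?_⟩
        rw [h1]
        ext x
        simp
        ring) hf
    exact ⟨g, fun x => by rw [← hg]; rfl⟩
  · rintro ⟨g, hg⟩
    have : f = g - g.comp (zAction φ (Multiplicative.ofAdd 1) : C(X, X)) := by
      rw [h1]; ext x; exact hg x
    rw [this, map_sub, toH0_comp, sub_self]

theorem toH0_ZZ2_eq_zero_iff (α : ZZ2 →* (X ≃ₜ X)) (f : C(X, ℤ)) :
    toH0 α f = 0 ↔ ∃ u v : C(X, ℤ), ∀ x,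
      f x = (u x - u (phi α x)) + (v x - v (sigma α x)) := by
  constructor
  · intro hf
    let N : AddSubgroup C(X, ℤ) := (AddMonoidHom.mk'
      (fun g : C(X, ℤ) × C(X, ℤ) => (g.1 - g.1.comp (phi α : C(X, X))) +
        (g.2 - g.2.comp (sigma α : C(X, X)))) fun a b => by
        ext x; simp; ring).range
    obtain ⟨g, hg⟩ := mem_of_toH0_eq_zero α N closure_phi_sigma
      (by
        rintro _ (rfl | rfl) f
        · refine ⟨(-f, 0), ?_⟩
          ext x
          simp [phi]
          ring
        · refine ⟨(0, -f), ?_⟩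
          ext x
          simp [sigma]
          ring) hf
    exact ⟨g.1, g.2, fun x => by rw [← hg]; rfl⟩
  · rintro ⟨u, v, h⟩
    have : f = (u - u.comp (phi α : C(X, X))) + (v - v.comp (sigma α : C(X, X))) :=
      ContinuousMap.ext h
    rw [this, map_add, map_sub, map_sub, phi, sigma, toH0_comp, toH0_comp]
    simp

theorem sigmaStar_toH0 (α : ZZ2 →* (X ≃ₜ X)) (f : C(X, ℤ)) :
    sigmaStar α 0 (toH0 (zAction (phi α)) f) =
      toH0 (zAction (phi α)) (f.comp (sigma α : C(X, X))) :=
  groupHomology.H0π_comp_map_apply (MulEquiv.inv (Multiplicative ℤ)).toMonoidHom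
    (sigmaPullback α) f

/-- The map `f ↦ [f + f ∘ σ]` from `C(X, ℤ)` onto `(1 + σ_*) H_0(ℤ, C(X, ℤ))`. -/
def toOnePlusSigma (α : ZZ2 →* (X ≃ₜ X)) : C(X, ℤ) →+ onePlusSigma α :=
  (AddMonoidHom.rangeRestrict (AddMonoidHom.id (homZ (phi α) 0) + sigmaStar α 0)).comp
    (toH0 (zAction (phi α)))

theorem toOnePlusSigma_surjective (α : ZZ2 →* (X ≃ₜ X)) :
    Function.Surjective (toOnePlusSigma α) :=
  (AddMonoidHom.rangeRestrict_surjective _).comp (toH0_surjective _)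

theorem toOnePlusSigma_eq_zero_iff (α : ZZ2 →* (X ≃ₜ X)) (f : C(X, ℤ)) :
    toOnePlusSigma α f = 0 ↔
      ∃ g : C(X, ℤ), ∀ x, f x + f (sigma α x) = g x - g (phi α x) := by
  refine Iff.trans ?_ (toH0_zAction_eq_zero_iff (phi α) (f + f.comp (sigma α : C(X, X))))
  rw [Subtype.ext_iff, map_add, ← sigmaStar_toH0]
  rfl

end ToH0

/-! ### Functions and involutions on a space that injects into the line -/

section Involutions

variable {X : Type*} [TopologicalSpace X]

/-- The characteristic function of a clopen set. -/
def charMap (U : Set X) (hU : IsClopen U) : C(X, ℤ) :=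
  (LocallyConstant.charFn ℤ hU : C(X, ℤ))

theorem charMap_of_mem {U : Set X} (hU : IsClopen U) {x : X} (hx : x ∈ U) :
    charMap U hU x = 1 :=
  (LocallyConstant.charFn_eq_one ℤ x hU).2 hx

theorem charMap_of_notMem {U : Set X} (hU : IsClopen U) {x : X} (hx : x ∉ U) :
    charMap U hU x = 0 :=
  (LocallyConstant.charFn_eq_zero ℤ x hU).2 hx

/-- An involution without fixed points on an invariant clopen set has a clopen fundamental domain
there, provided that there is a continuous injection into the reals. -/
theorem exists_isClopen_half {h : X → ℝ} (hc : Continuous h) (hi : Function.Injective h)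
    {s : X ≃ₜ X} (hs : ∀ x, s (s x) = x) {W : Set X} (hW : IsClopen W)
    (hWs : ∀ x ∈ W, s x ∈ W) (hfree : ∀ x ∈ W, s x ≠ x) :
    ∃ U : Set X, IsClopen U ∧ U ⊆ W ∧ ∀ x ∈ W, (s x ∈ U ↔ x ∉ U) := by
  have hlt : IsOpen {x | h x < h (s x)} := isOpen_lt hc (hc.comp s.continuous)
  have hgt : IsOpen {x | h (s x) < h x} := isOpen_lt (hc.comp s.continuous) hc
  have hne : ∀ x ∈ W, h (s x) ≠ h x := fun x hx e => hfree x hx (hi e)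
  refine ⟨W ∩ {x | h x < h (s x)}, ⟨?_, hW.isOpen.inter hlt⟩, Set.inter_subset_left, ?_⟩
  -- On `W` the values `h x` and `h (s x)` differ, so the strict and the weak inequality cut out the
  -- same set, which is therefore closed as well as open.
  · have : W ∩ {x | h x < h (s x)} = W ∩ {x | h (s x) < h x}ᶜ := by
      ext x
      simp only [Set.mem_inter_iff, Set.mem_ofPred_eq, Set.mem_compl_iff, not_lt]
      exact and_congr_right fun hx => ⟨le_of_lt, fun hl => hl.lt_of_ne (hne x hx).symm⟩
    rw [this]
    exact hW.isClosed.inter hgt.isClosed_compl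
  · intro x hx
    simp only [Set.mem_inter_iff, Set.mem_ofPred_eq, hWs x hx, hx, true_and, hs, not_lt]
    exact ⟨le_of_lt, fun hl => hl.lt_of_ne (hne x hx)⟩

/-- A fixed point forces `f x = -f x`, so the support of `f` is free of them; `g` is `f` cut off to
a fundamental domain of the support. -/
theorem exists_eq_sub_of_anti {h : X → ℝ} (hc : Continuous h) (hi : Function.Injective h)
    {s : X ≃ₜ X} (hs : ∀ x, s (s x) = x) {f : C(X, ℤ)} (hf : ∀ x, f (s x) = - f x) :
    ∃ g : C(X, ℤ), ∀ x, f x = g x - g (s x) := by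
  have hW : IsClopen {x | f x ≠ 0} := (isClopen_discrete {n : ℤ | n ≠ 0}).preimage f.continuous
  obtain ⟨U, hU, hUW, h2⟩ := exists_isClopen_half hc hi hs hW
    (fun x (hx : f x ≠ 0) => show f (s x) ≠ 0 by rw [hf]; simpa using hx)
    (fun x (hx : f x ≠ 0) e => hx (by have := hf x; rw [e] at this; omega))
  refine ⟨charMap U hU * f, fun x => ?_⟩
  rw [ContinuousMap.mul_apply, ContinuousMap.mul_apply, hf]
  by_cases hx : f x = 0
  · simp [hx]
  · by_cases hxU : x ∈ U
    · rw [charMap_of_mem hU hxU, charMap_of_notMem hU (fun h' => (h2 x hx).1 h' hxU)]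
      ring
    · rw [charMap_of_notMem hU hxU, charMap_of_mem hU ((h2 x hx).2 hxU)]
      ring

/-- Where `f` is odd there are no fixed points, and `g` carries all of `f` on one half; where `f` is
even, `g` is `f / 2`. -/
theorem exists_eq_add_of_invariant {h : X → ℝ} (hc : Continuous h) (hi : Function.Injective h)
    {s : X ≃ₜ X} (hs : ∀ x, s (s x) = x) {f : C(X, ℤ)} (hf : ∀ x, f (s x) = f x)
    (heven : ∀ x, s x = x → Even (f x)) :
    ∃ g : C(X, ℤ), ∀ x, f x = g x + g (s x) := by
  have hW : IsClopen {x | Odd (f x)} := (isClopen_discrete {n : ℤ | Odd n}).preimage f.continuous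
  obtain ⟨U, hU, hUW, h2⟩ := exists_isClopen_half hc hi hs hW
    (fun x (hx : Odd (f x)) => show Odd (f (s x)) by rwa [hf])
    (fun x (hx : Odd (f x)) e => Int.not_even_iff_odd.2 hx (heven x e))
  let g2 : C(X, ℤ) := ⟨fun x => f x / 2, (continuous_of_discreteTopology (f := fun n : ℤ => n / 2)).comp f.continuous⟩
  refine ⟨charMap U hU * f + (1 - charMap _ hW) * g2, fun x => ?_⟩
  have hg2 : ∀ x, g2 x = f x / 2 := fun _ => rfl
  simp only [ContinuousMap.add_apply, ContinuousMap.mul_apply, ContinuousMap.sub_apply,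
    ContinuousMap.one_apply, hg2, hf]
  by_cases hx : Odd (f x)
  · rw [charMap_of_mem hW hx, charMap_of_mem hW (show Odd (f (s x)) by rwa [hf])]
    by_cases hxU : x ∈ U
    · rw [charMap_of_mem hU hxU, charMap_of_notMem hU (fun h' => (h2 x hx).1 h' hxU)]
      ring
    · rw [charMap_of_notMem hU hxU, charMap_of_mem hU ((h2 x hx).2 hxU)]
      ring
  · rw [charMap_of_notMem hW hx, charMap_of_notMem hW (show ¬ Odd (f (s x)) by rwa [hf]),
      charMap_of_notMem hU (fun h' => hx (hUW h')),
      charMap_of_notMem hU (fun h' => hx (by simpa [hf] using hUW h'))]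
    obtain ⟨k, hk⟩ := Int.not_odd_iff_even.1 hx
    omega

/-- The two level sets of `c` are disjoint closed subsets of `X`, separated by a clopen `V`. The
union of `V` and its preimage under `s` is invariant and has the same fixed points as `V`. -/
theorem exists_invariant_extension [CompactSpace X] [T2Space X] [TotallyDisconnectedSpace X]
    {s : X ≃ₜ X} (hs : ∀ x, s (s x) = x) (c : C(Function.fixedPoints s, ZMod 2)) :
    ∃ f : C(X, ℤ), (∀ x, f (s x) = f x) ∧ ∀ x : Function.fixedPoints s, (f x : ZMod 2) = c x := by
  have hF : IsClosed (Function.fixedPoints s) := isClosed_fixedPoints s.continuous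
  have hcl : ∀ a : ZMod 2, IsClosed ((↑) '' (c ⁻¹' {a}) : Set X) := fun a =>
    hF.isClosedEmbedding_subtypeVal.isClosedMap _ ((isClosed_discrete {a}).preimage c.continuous)
  obtain ⟨V, hV, h1, h0⟩ := exists_clopen_of_closed_subset_open (hcl 1) (hcl 0).isOpen_compl (by
    rintro _ ⟨x, hx, rfl⟩ ⟨y, hy, hxy⟩
    rw [Subtype.ext hxy, Set.mem_preimage, Set.mem_singleton_iff] at hy
    rw [Set.mem_preimage, Set.mem_singleton_iff, hy] at hx
    exact absurd hx (by decide))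
  have hU : IsClopen (V ∪ s ⁻¹' V) := hV.union (hV.preimage s.continuous)
  refine ⟨charMap _ hU, fun x => ?_, fun x => ?_⟩
  · have : s x ∈ V ∪ s ⁻¹' V ↔ x ∈ V ∪ s ⁻¹' V := by simp [hs, or_comm]
    by_cases hx : x ∈ V ∪ s ⁻¹' V
    · rw [charMap_of_mem hU hx, charMap_of_mem hU (this.2 hx)]
    · rw [charMap_of_notMem hU hx, charMap_of_notMem hU (fun h => hx (this.1 h))]
  · have hx : s x = x := x.2
    have key : ∀ a : ZMod 2, a = 0 ∨ a = 1 := by decide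
    rcases key (c x) with hc | hc
    · rw [charMap_of_notMem hU, hc, Int.cast_zero]
      have : (x : X) ∉ V := fun hxV => h0 hxV ⟨x, hc, rfl⟩
      simp [hx, this]
    · rw [charMap_of_mem hU (Or.inl (h1 ⟨x, hc, rfl⟩)), hc, Int.cast_one]

end Involutions

/-! ### Minimal sets and invariant functions -/

section Minimality

variable {X : Type} [TopologicalSpace X]

theorem eq_of_invariant_of_isMinimal {Γ T : Type*} [Group Γ] [TopologicalSpace T] [T2Space T]
    {α : Γ →* (X ≃ₜ X)} (hα : ∀ x : X, Dense (Set.range fun g : Γ => α g x)) {f : X → T}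
    (hf : Continuous f) (hinv : ∀ g x, f (α g x) = f x) (x y : X) : f x = f y := by
  have : f = fun _ => f y := hf.ext_on (hα y) continuous_const (by
    rintro _ ⟨g, rfl⟩
    exact hinv g y)
  exact congrFun this x

theorem zAction_ofAdd (φ : X ≃ₜ X) (n : ℤ) : zAction φ (Multiplicative.ofAdd n) = φ ^ n := by
  simp [zAction]

theorem zpow_apply_mem {φ : X ≃ₜ X} {S : Set X} (hS : ∀ x, φ x ∈ S ↔ x ∈ S) (n : ℤ) (x : X) :
    (φ ^ n) x ∈ S ↔ x ∈ S := by
  induction n generalizing x with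
  | zero => simp
  | succ n ih =>
    rw [zpow_add_one]
    exact (ih (φ x)).trans (hS x)
  | pred n ih =>
    rw [zpow_sub_one]
    refine (ih (φ.symm x)).trans ((hS _).symm.trans ?_)
    rw [φ.apply_symm_apply]

theorem eq_of_invariant_of_isMinimal_zAction {T : Type*} [TopologicalSpace T] [T2Space T]
    {φ : X ≃ₜ X} (hφ : IsMinimalAction (zAction φ)) {f : X → T}
    (hf : Continuous f) (hinv : ∀ x, f (φ x) = f x) (x y : X) : f x = f y := by
  refine eq_of_invariant_of_isMinimal hφ hf (fun g x => ?_) x y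
  have := zpow_apply_mem (φ := φ) (S := {y | f y = f x}) (fun y => by simp [hinv]) g.toAdd x
  rw [← zAction_ofAdd] at this
  exact this.2 rfl

theorem dense_orbit_of_minimal_closed {φ : X ≃ₜ X} {Y : Set X} (hYc : IsClosed Y)
    (hY : ∀ x, φ x ∈ Y ↔ x ∈ Y)
    (hmin : ∀ C ⊆ Y, IsClosed C → C.Nonempty → (∀ x, φ x ∈ C ↔ x ∈ C) → C = Y)
    {x : X} (hx : x ∈ Y) : closure (Set.range fun g => zAction φ g x) = Y := by
  refine hmin _ (closure_minimal ?_ hYc) isClosed_closure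
    ⟨x, subset_closure ⟨1, by simp⟩⟩ fun y => ?_
  · rintro _ ⟨g, rfl⟩
    exact (zpow_apply_mem hY g.toAdd x).2 hx
  · have : φ ⁻¹' (Set.range fun g => zAction φ g x) = Set.range fun g => zAction φ g x := by
      ext y
      constructor
      · rintro ⟨g, hg⟩
        refine ⟨(Multiplicative.ofAdd 1)⁻¹ * g, ?_⟩
        change zAction φ _ x = y
        rw [map_mul, map_inv, zAction_ofAdd, zpow_one]
        exact (congrArg φ.symm hg).trans (φ.symm_apply_apply y)
      · rintro ⟨g, rfl⟩
        refine ⟨Multiplicative.ofAdd 1 * g, ?_⟩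
        change zAction φ _ x = φ (zAction φ g x)
        rw [map_mul, zAction_ofAdd, zpow_one]
        rfl
    conv_rhs => rw [← this, ← φ.preimage_closure]
    rfl

theorem exists_minimal_closed [CompactSpace X] [Nonempty X] (φ : X ≃ₜ X) :
    ∃ Y : Set X, IsClosed Y ∧ Y.Nonempty ∧ (∀ x, φ x ∈ Y ↔ x ∈ Y) ∧
      ∀ C ⊆ Y, IsClosed C → C.Nonempty → (∀ x, φ x ∈ C ↔ x ∈ C) → C = Y := by
  let S : Set (Set X) := {C | IsClosed C ∧ C.Nonempty ∧ ∀ x, φ x ∈ C ↔ x ∈ C}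
  obtain ⟨Y, -, hY⟩ := zorn_superset_nonempty S (fun c hc hchain hne => by
    refine ⟨⋂₀ c, ⟨isClosed_sInter fun C hC => (hc hC).1, ?_, fun x => ?_⟩,
      fun C hC => Set.sInter_subset_of_mem hC⟩
    · have := hne.to_subtype
      rw [Set.sInter_eq_iInter]
      exact IsCompact.nonempty_iInter_of_directed_nonempty_isCompact_isClosed _
        (fun a b => (hchain.total a.2 b.2).elim (fun h => ⟨a, subset_rfl, h⟩)
          fun h => ⟨b, h, subset_rfl⟩) (fun C => (hc C.2).2.1)
        (fun C => (hc C.2).1.isCompact) fun C => (hc C.2).1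
    · simp only [Set.mem_sInter]
      exact forall₂_congr fun C hC => (hc hC).2.2 x) Set.univ
    ⟨isClosed_univ, Set.univ_nonempty, by simp⟩
  exact ⟨Y, hY.prop.1, hY.prop.2.1, hY.prop.2.2, fun C hCY h1 h2 h3 =>
    hCY.antisymm (hY.le_of_le ⟨h1, h2, h3⟩ hCY)⟩

theorem restrictHomeo_zpow (φ : X ≃ₜ X) (Y : Set X) (hY : φ '' Y = Y) (n : ℤ) (y : Y) :
    ((restrictHomeo φ Y hY ^ n) y : X) = (φ ^ n) y := by
  have h : ∀ y : Y, (restrictHomeo φ Y hY y : X) = φ y := fun _ => rfl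
  induction n generalizing y with
  | zero => rfl
  | succ n ih =>
    rw [zpow_add_one, zpow_add_one]
    exact ih _
  | pred n ih =>
    rw [zpow_sub_one, zpow_sub_one]
    refine (ih _).trans (congrArg (φ ^ (-(n : ℤ))) ?_)
    exact rfl

end Minimality

/-! ### Dihedral actions: minimality of `φ` and fixed points -/

section Dihedral

variable {X : Type} [TopologicalSpace X] (α : ZZ2 →* (X ≃ₜ X))

theorem sigma_sigma (x : X) : sigma α (sigma α x) = x := by
  have : sigma α * sigma α = 1 := by
    rw [sigma, ← map_mul, ← map_one α]
    rfl
  exact DFunLike.congr_fun this x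

theorem phi_sigma_phi (x : X) : phi α (sigma α (phi α x)) = sigma α x := by
  have : phi α * sigma α * phi α = sigma α := by
    rw [sigma, phi, ← map_mul, ← map_mul]
    rfl
  exact DFunLike.congr_fun this x

theorem apply_eq (g : ZZ2) :
    ∃ n : ℤ, g.left = Multiplicative.ofAdd n ∧
      ((g.right = 1 ∧ ∀ x, α g x = (phi α ^ n) x) ∨
        (g.right ≠ 1 ∧ ∀ x, α g x = (phi α ^ n) (sigma α x))) := by
  refine ⟨g.left.toAdd, rfl, ?_⟩
  have hl : α (SemidirectProduct.inl g.left) = phi α ^ g.left.toAdd := by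
    rw [phi, ← map_zpow, ← map_zpow, ← ofAdd_zsmul]
    simp
  have key : ∀ i : Multiplicative (ZMod 2), i = 1 ∨ (i ≠ 1 ∧ i = Multiplicative.ofAdd 1) := by
    decide
  rcases key g.right with h | ⟨h1, h2⟩
  · refine Or.inl ⟨h, fun x => ?_⟩
    conv_lhs => rw [← SemidirectProduct.inl_left_mul_inr_right g, h, MonoidHom.map_one, mul_one, hl]
  · refine Or.inr ⟨h1, fun x => ?_⟩
    conv_lhs => rw [← SemidirectProduct.inl_left_mul_inr_right g, h2, map_mul, hl]
    rfl

theorem apply_mem_iff {S : Set X} (h1 : ∀ x, phi α x ∈ S ↔ x ∈ S)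
    (h2 : ∀ x, sigma α x ∈ S ↔ x ∈ S) (g : ZZ2) (x : X) : α g x ∈ S ↔ x ∈ S := by
  obtain ⟨n, -, ⟨-, h⟩ | ⟨-, h⟩⟩ := apply_eq α g
  · rw [h, zpow_apply_mem h1]
  · rw [h, zpow_apply_mem h1, h2]

variable {α}

theorem eq_of_invariant (hα : IsMinimalAction α) {T : Type*} [TopologicalSpace T] [T2Space T]
    {f : X → T} (hf : Continuous f) (h1 : ∀ x, f (phi α x) = f x)
    (h2 : ∀ x, f (sigma α x) = f x) (x y : X) : f x = f y :=
  eq_of_invariant_of_isMinimal hα hf (fun g x =>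
    (apply_mem_iff α (S := {y | f y = f x}) (fun y => by simp [h1]) (fun y => by simp [h2])
      g x).2 rfl) x y

/-- If `φ` is not minimal, then `X` is the union of a minimal clopen set and its image by `σ`. -/
theorem exists_clopen_minimal [CompactSpace X] [Nonempty X] (hα : IsMinimalAction α)
    (hφ : ¬ IsMinimalAction (zAction (phi α))) :
    ∃ Y : Set X, IsClopen Y ∧ (∀ x, phi α x ∈ Y ↔ x ∈ Y) ∧ (∀ x, sigma α x ∈ Y ↔ x ∉ Y) ∧
      ∀ x ∈ Y, closure (Set.range fun g => zAction (phi α) g x) = Y := by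
  obtain ⟨Y, hYc, hYne, hY, hmin⟩ := exists_minimal_closed (phi α)
  have hdense := fun x hx => dense_orbit_of_minimal_closed hYc hY hmin (x := x) hx
  let Y' : Set X := sigma α ⁻¹' Y
  have hY'c : IsClosed Y' := hYc.preimage (sigma α).continuous
  have hY' : ∀ x, phi α x ∈ Y' ↔ x ∈ Y' := fun x => by
    change sigma α (phi α x) ∈ Y ↔ sigma α x ∈ Y
    rw [← hY, phi_sigma_phi]
  have hunion : ∀ x, x ∈ Y ∨ x ∈ Y' := by
    obtain ⟨y, hy⟩ := hYne
    -- `Y ∪ Y'` is closed and invariant under the whole group, so it contains a dense orbit.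
    have h := closure_minimal (s := Set.range fun g => α g y) (t := Y ∪ Y') (by
      rintro _ ⟨g, rfl⟩
      refine (apply_mem_iff α (fun x => or_congr (hY x) (hY' x)) (fun x => ?_) g y).2 (Or.inl hy)
      change (_ ∨ sigma α (sigma α x) ∈ Y) ↔ _
      rw [sigma_sigma]
      exact or_comm) (hYc.union hY'c)
    rw [(hα y).closure_eq] at h
    exact fun x => h (Set.mem_univ x)
  have hdisj : ∀ x ∈ Y, x ∉ Y' := by
    intro x hx hx'
    -- A common point would give `Y ⊆ Y'`, hence `Y = X`, and `φ` would be minimal.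
    have hYY' : Y ∩ Y' = Y := hmin _ Set.inter_subset_left (hYc.inter hY'c) ⟨x, hx, hx'⟩
      fun x => and_congr (hY x) (hY' x)
    have huniv : ∀ x, x ∈ Y := fun x => by
      rcases hunion x with h | h
      · exact h
      · have : sigma α x ∈ Y ∩ Y' := by rw [hYY']; exact h
        have h2 : sigma α (sigma α x) ∈ Y := this.2
        rwa [sigma_sigma] at h2
    refine hφ fun x => ?_
    rw [dense_iff_closure_eq, hdense x (huniv x)]
    exact Set.eq_univ_of_forall huniv
  have hiff : ∀ x, sigma α x ∈ Y ↔ x ∉ Y := fun x =>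
    ⟨fun h h' => hdisj x h' h, fun h => (hunion x).resolve_left h⟩
  refine ⟨Y, ⟨hYc, ?_⟩, hY, hiff, hdense⟩
  have : Y = Y'ᶜ := by
    ext x
    exact ⟨hdisj x, fun h => (hunion x).resolve_right h⟩
  rw [this]
  exact hY'c.isOpen_compl

/-- As `σ` conjugates `φⁿ` to its inverse, `φⁿ` fixes `σ x` too. The dihedral orbit of `x` consists
of two finite `φ`-orbits, and a dense finite set is everything. -/
theorem finite_of_zpow_apply_eq [T1Space X] (hα : IsMinimalAction α) {n : ℤ} (hn : n ≠ 0) {x : X}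
    (hx : (phi α ^ n) x = x) : Finite X := by
  have hx' : (phi α ^ n) (sigma α x) = sigma α x := by
    have h1 := DFunLike.congr_fun (phi_zpow_mul_sigma α n) x
    refine h1.trans (congrArg (sigma α) ?_)
    have h2 := congrArg (phi α ^ (-n)) hx
    have h3 : (phi α ^ (-n)) ((phi α ^ n) x) = x := by
      rw [← Homeomorph.mul_apply, ← zpow_add]
      simp
    exact h2.symm.trans h3
  have hred : ∀ y, (phi α ^ n) y = y → ∀ m : ℤ, (phi α ^ m) y = (phi α ^ (m % n)) y := by
    intro y hy m
    conv_lhs => rw [← Int.emod_add_mul_ediv m n, zpow_add, zpow_mul]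
    refine congrArg (phi α ^ (m % n)) ?_
    refine (zpow_apply_mem (φ := phi α ^ n) (S := {y}) (fun z => ?_) (m / n) y).2 rfl
    rw [Set.mem_singleton_iff, Set.mem_singleton_iff]
    conv_lhs => rw [← hy]
    exact (phi α ^ n).injective.eq_iff
  let O : Set X := ((fun m : ℤ => (phi α ^ m) x) '' Set.Ico 0 |n|) ∪
    ((fun m : ℤ => (phi α ^ m) (sigma α x)) '' Set.Ico 0 |n|)
  have hO : O.Finite := ((Set.finite_Ico _ _).image _).union ((Set.finite_Ico _ _).image _)
  have hmem : ∀ m : ℤ, m % n ∈ Set.Ico 0 |n| := fun m =>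
    ⟨Int.emod_nonneg m hn, Int.emod_lt_abs m hn⟩
  have h := closure_minimal (s := Set.range fun g => α g x) (t := O) (by
    rintro _ ⟨g, rfl⟩
    obtain ⟨m, -, ⟨-, h⟩ | ⟨-, h⟩⟩ := apply_eq α g
    · exact Or.inl ⟨m % n, hmem m, ((h x).trans (hred x hx m)).symm⟩
    · exact Or.inr ⟨m % n, hmem m, ((h x).trans (hred _ hx' m)).symm⟩) hO.isClosed
  rw [(hα x).closure_eq] at h
  exact Set.finite_univ_iff.1 (hO.subset h)

/-- A nonfree minimal action on an infinite space has a reflection in `{σ, φσ}` with a fixed point,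
and its restriction to `ℤ` is minimal. -/
theorem minimal_and_exists_fixed_of_not_free [CompactSpace X] [Nonempty X] [T1Space X] [Infinite X]
    (hα : IsMinimalAction α) (hfree : ¬ IsFreeAction α) :
    IsMinimalAction (zAction (phi α)) ∧
      ∃ x, sigma α x = x ∨ phi α (sigma α x) = x := by
  unfold IsFreeAction at hfree
  push Not at hfree
  obtain ⟨g, x, hgx, hg⟩ := hfree
  obtain ⟨n, hn, ⟨h1, h⟩ | ⟨h1, h⟩⟩ := apply_eq α g
  · exfalso
    have hn0 : n ≠ 0 := by
      rintro rfl
      exact hg (SemidirectProduct.ext hn h1)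
    exact not_finite_iff_infinite.2 ‹_› (finite_of_zpow_apply_eq hα hn0 ((h x).symm.trans hgx))
  · have hx : (phi α ^ n) (sigma α x) = x := (h x).symm.trans hgx
    constructor
    · by_contra hφ
      obtain ⟨Y, -, hY, hσ, -⟩ := exists_clopen_minimal hα hφ
      -- `φⁿσ` exchanges `Y` with its complement, so it cannot fix a point.
      have := (zpow_apply_mem hY n (sigma α x)).trans (hσ x)
      rw [hx] at this
      exact iff_not_self this
    · have hswap : ∀ k : ℤ, sigma α ((phi α ^ (-k)) x) = (phi α ^ k) (sigma α x) := fun k =>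
        (DFunLike.congr_fun (phi_zpow_mul_sigma α k) x).symm
      have hback : ∀ k : ℤ, (phi α ^ (k - n)) x = (phi α ^ k) (sigma α x) := fun k => by
        conv_lhs => rw [← hx]
        rw [zpow_sub, ← Homeomorph.mul_apply]
        simp
      -- `φ⁻ᵏ(φⁿσ)φᵏ = φⁿ⁻²ᵏσ` fixes `φ⁻ᵏ x`; with `k` half of `n`, rounded down, this is `σ` or
      -- `φσ`.
      rcases Int.even_or_odd' n with ⟨k, hk | hk⟩
      · refine ⟨(phi α ^ (-k)) x, Or.inl ?_⟩
        rw [hswap, ← hback, hk]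
        congr 2
        ring
      · refine ⟨(phi α ^ (-k)) x, Or.inr ?_⟩
        rw [hswap]
        have : phi α ((phi α ^ k) (sigma α x)) = (phi α ^ (k + 1)) (sigma α x) := by
          rw [add_comm, zpow_one_add]
          rfl
        rw [this, ← hback, hk]
        congr 2
        ring

end Dihedral

/-- Functions on `Bool` as pairs. -/
def boolFinsuppEquiv (M : Type*) [AddCommGroup M] : (Bool →₀ M) ≃+ M × M where
  toFun m := (m true, m false)
  invFun m := Finsupp.single true m.1 + Finsupp.single false m.2
  left_inv m := Finsupp.ext fun i => by cases i <;> simp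
  right_inv m := by simp
  map_add' _ _ := rfl

/-! ### Chains as pairs of functions -/

section Pairs

variable {X : Type} [TopologicalSpace X] (α : ZZ2 →* (X ≃ₜ X))

theorem chainD_apply {A : Rep ℤ ZZ2} (n : ℕ) (m : Bool →₀ A) :
    chainD A n m = Finsupp.single (target n true)
        (A.ρ (refl true) (m true) + (-1 : ℤ) ^ (n + 1) • m true) +
      Finsupp.single (target n false)
        (A.ρ (refl false) (m false) + (-1 : ℤ) ^ (n + 1) • m false) := by
  conv_lhs => rw [← Finsupp.univ_sum_single m]
  rw [Fintype.sum_bool, map_add, chainD_single, chainD_single]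

/-- The pair of functions `f₁ ∘ σ + ε f₁` and `f₂ ∘ φσ + ε f₂`. -/
def reflPair (e : ℤ) (m : C(X, ℤ) × C(X, ℤ)) : C(X, ℤ) × C(X, ℤ) :=
  (m.1.comp (sigma α : C(X, X)) + e • m.1,
    m.2.comp ((phi α * sigma α : X ≃ₜ X) : C(X, X)) + e • m.2)

/-- The condition that a pair of functions is an `(n + 1)`-cycle. -/
def IsCyclePair : ℕ → C(X, ℤ) × C(X, ℤ) → Prop
  | 0, m => (reflPair α (-1) m).1 + (reflPair α (-1) m).2 = 0
  -- The differential out of degree `n + 2` has sign `(-1)ⁿ⁺² = (-1)ⁿ`. Only out of degree one do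
  -- both components land in the same copy of `C(X, ℤ)`.
  | n + 1, m => reflPair α ((-1) ^ n) m = 0

theorem rho_refl (i : Bool) (f : C(X, ℤ)) :
    (functionRep α).ρ (refl i) f = f.comp (α (refl i) : C(X, X)) := by
  change f.comp (α (refl i)⁻¹ : C(X, X)) = _
  rw [refl_inv]

/-- Chains with coefficients in `C(X, ℤ)` as pairs of functions. -/
def pairEquiv : (Bool →₀ functionRep α) ≃+ C(X, ℤ) × C(X, ℤ) :=
  boolFinsuppEquiv (functionRep α)

theorem pairEquiv_chainD_succ (n : ℕ) (m : Bool →₀ functionRep α) :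
    pairEquiv α (chainD (functionRep α) (n + 1) m) = reflPair α ((-1) ^ n) (pairEquiv α m) := by
  rw [chainD_apply]
  have hf : α (refl false) = phi α * sigma α := map_mul _ _ _
  have he : (-1 : ℤ) ^ (n + 1 + 1) = (-1) ^ n := by ring
  rw [he]
  refine Prod.ext ?_ ?_
  · change (Finsupp.single true _ + Finsupp.single false _ : Bool →₀ functionRep α) true = _
    rw [Finsupp.add_apply, Finsupp.single_eq_same, Finsupp.single_eq_of_ne (by simp), add_zero]
    exact congrArg (· + (-1 : ℤ) ^ n • (pairEquiv α m).1) (rho_refl α true _)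
  · change (Finsupp.single true _ + Finsupp.single false _ : Bool →₀ functionRep α) false = _
    rw [Finsupp.add_apply, Finsupp.single_eq_same, Finsupp.single_eq_of_ne (by simp), zero_add]
    refine congrArg (· + (-1 : ℤ) ^ n • (pairEquiv α m).2) ((rho_refl α false _).trans ?_)
    rw [hf]
    rfl

theorem chainD_zero_eq_zero_iff (m : Bool →₀ functionRep α) :
    chainD (functionRep α) 0 m = 0 ↔ IsCyclePair α 0 (pairEquiv α m) := by
  rw [chainD_apply, ← Finsupp.single_add, Finsupp.single_eq_zero]
  have hf : α (refl false) = phi α * sigma α := map_mul _ _ _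
  have h1 := rho_refl α true (m true)
  have h2 := rho_refl α false (m false)
  rw [hf] at h2
  rw [h1, h2]
  rfl

/-- Computation of the homology of `ℤ ⋊ ℤ/2` with coefficients in `C(X, ℤ)` through a surjection
on the cycles that vanishes exactly on the boundaries. -/
theorem nonempty_homZZ2_addEquiv (n : ℕ) {B : Type*} [AddCommGroup B]
    (F : C(X, ℤ) × C(X, ℤ) →+ B) (hF : ∀ b, ∃ m, IsCyclePair α n m ∧ F m = b)
    (hF0 : ∀ m, IsCyclePair α n m → (F m = 0 ↔ ∃ y, reflPair α ((-1) ^ n) y = m)) :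
    Nonempty (homZZ2 α (n + 1) ≃+ B) := by
  have hcyc : ∀ m, m ∈ (chainD (functionRep α) n).ker ↔ IsCyclePair α n (pairEquiv α m) := by
    intro m
    cases n with
    | zero => exact chainD_zero_eq_zero_iff α m
    | succ n =>
      rw [AddMonoidHom.mem_ker]
      refine (map_eq_zero_iff (pairEquiv α) (pairEquiv α).injective).symm.trans ?_
      rw [pairEquiv_chainD_succ]
      rfl
  refine nonempty_groupHomology_addEquiv (functionRep α) n
    ((F.comp (pairEquiv α).toAddMonoidHom).comp (AddSubgroup.subtype _)) ?_ ?_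
  · intro b
    obtain ⟨m, hm, rfl⟩ := hF b
    exact ⟨⟨(pairEquiv α).symm m, (hcyc _).2 (by simpa using hm)⟩,
      congrArg F ((pairEquiv α).apply_symm_apply m)⟩
  · intro z
    refine (hF0 _ ((hcyc z).1 z.2)).trans ?_
    rw [(pairEquiv α).surjective.exists]
    refine exists_congr fun y => ?_
    rw [← pairEquiv_chainD_succ]
    exact (pairEquiv α).injective.eq_iff

theorem isCyclePair_zero_iff (m : C(X, ℤ) × C(X, ℤ)) : IsCyclePair α 0 m ↔
    ∀ x, m.1 (sigma α x) - m.1 x + (m.2 (phi α (sigma α x)) - m.2 x) = 0 := by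
  rw [IsCyclePair, ContinuousMap.ext_iff]
  simp [reflPair, sub_eq_add_neg]

theorem reflPair_eq_iff (e : ℤ) (m m' : C(X, ℤ) × C(X, ℤ)) : reflPair α e m = m' ↔
    (∀ x, m.1 (sigma α x) + e * m.1 x = m'.1 x) ∧
      ∀ x, m.2 (phi α (sigma α x)) + e * m.2 x = m'.2 x := by
  rw [Prod.ext_iff, ContinuousMap.ext_iff, ContinuousMap.ext_iff]
  simp [reflPair]

end Pairs

theorem intCast_zmod_two_eq_zero_iff (n : ℤ) : (n : ZMod 2) = 0 ↔ Even n :=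
  (ZMod.intCast_zmod_eq_zero_iff_dvd n 2).trans even_iff_two_dvd.symm

/-! ### Homology in positive degrees -/

section Higher

variable {X : Type} [TopologicalSpace X] {α : ZZ2 →* (X ≃ₜ X)}

theorem phi_sigma_involutive (x : X) :
    (phi α * sigma α) ((phi α * sigma α) x) = x := by
  change phi α (sigma α (phi α (sigma α x))) = x
  rw [phi_sigma_phi, sigma_sigma]

/-- The homology of `ℤ ⋊ ℤ/2` with coefficients in `C(X, ℤ)` vanishes in positive even degrees. -/
theorem subsingleton_homZZ2_even {h : X → ℝ} (hc : Continuous h) (hi : Function.Injective h)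
    {n : ℕ} (hn : Even n) : Subsingleton (homZZ2 α (n + 2)) := by
  obtain ⟨E⟩ := nonempty_homZZ2_addEquiv α (n + 1) (0 : C(X, ℤ) × C(X, ℤ) →+ PUnit.{1})
    (fun b => ⟨0, by
      change reflPair α _ _ = 0
      rw [reflPair_eq_iff]
      simp, rfl⟩)
    (fun m hm => by
      refine iff_of_true rfl ?_
      change reflPair α _ _ = 0 at hm
      rw [reflPair_eq_iff, hn.neg_one_pow] at hm
      obtain ⟨g1, hg1⟩ := exists_eq_sub_of_anti hc hi (s := sigma α) (f := m.1) (sigma_sigma α)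
        fun x => by simpa [eq_neg_iff_add_eq_zero] using hm.1 x
      obtain ⟨g2, hg2⟩ := exists_eq_sub_of_anti hc hi (s := phi α * sigma α) (f := m.2)
        phi_sigma_involutive fun x => by simpa [eq_neg_iff_add_eq_zero] using hm.2 x
      refine ⟨(-g1, -g2), ?_⟩
      rw [reflPair_eq_iff, hn.add_one.neg_one_pow]
      refine ⟨fun x => ?_, fun x => ?_⟩
      · rw [hg1]; simp; ring
      · rw [hg2]; simp; ring)
  exact E.toEquiv.subsingleton

/-- Reduction modulo two of a pair of functions on the fixed points of `σ` and `φσ`. -/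
def fixedReduction (α : ZZ2 →* (X ≃ₜ X)) : C(X, ℤ) × C(X, ℤ) →+
    C(Function.fixedPoints (sigma α) ⊕ Function.fixedPoints (phi α * sigma α), ZMod 2) where
  toFun m := ⟨Sum.elim (fun x => (m.1 x : ZMod 2)) (fun x => (m.2 x : ZMod 2)),
    ((continuous_of_discreteTopology (f := fun n : ℤ => (n : ZMod 2))).comp
      (m.1.continuous.comp continuous_subtype_val)).sumElim
    ((continuous_of_discreteTopology (f := fun n : ℤ => (n : ZMod 2))).comp
      (m.2.continuous.comp continuous_subtype_val))⟩
  map_zero' := by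
    ext x
    cases x <;> simp
  map_add' m m' := by
    ext x
    cases x <;> simp

/-- The homology of `ℤ ⋊ ℤ/2` with coefficients in `C(X, ℤ)` in odd degrees, provided that the
components of cycles are invariant. -/
theorem nonempty_homZZ2_odd [CompactSpace X] [T2Space X] [TotallyDisconnectedSpace X]
    {h : X → ℝ} (hc : Continuous h) (hi : Function.Injective h) {n : ℕ} (hn : Even n)
    (hcyc : ∀ m, IsCyclePair α n m ↔ reflPair α (-1) m = 0) :
    Nonempty (homZZ2 α (n + 1) ≃+
      C(Function.fixedPoints (sigma α) ⊕ Function.fixedPoints (phi α * sigma α), ZMod 2)) := by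
  have hcyc' : ∀ m, IsCyclePair α n m ↔ (∀ x, m.1 (sigma α x) = m.1 x) ∧
      ∀ x, m.2 (phi α (sigma α x)) = m.2 x := fun m => by
    rw [hcyc, reflPair_eq_iff]
    simp [← sub_eq_add_neg, sub_eq_zero]
  refine nonempty_homZZ2_addEquiv α n (fixedReduction α) (fun b => ?_) fun m hm => ?_
  · obtain ⟨f1, hf1, hb1⟩ := exists_invariant_extension (s := sigma α) (sigma_sigma α)
      (b.comp ⟨Sum.inl, continuous_inl⟩)
    obtain ⟨f2, hf2, hb2⟩ := exists_invariant_extension (s := phi α * sigma α)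
      phi_sigma_involutive (b.comp ⟨Sum.inr, continuous_inr⟩)
    refine ⟨(f1, f2), (hcyc' _).2 ⟨hf1, hf2⟩, ?_⟩
    ext x
    rcases x with x | x
    · exact hb1 x
    · exact hb2 x
  · rw [hcyc'] at hm
    have hev : fixedReduction α m = 0 ↔ (∀ x, sigma α x = x → Even (m.1 x)) ∧
        ∀ x, (phi α * sigma α) x = x → Even (m.2 x) := by
      constructor
      · intro h0
        refine ⟨fun x hx => ?_, fun x hx => ?_⟩
        · exact (intCast_zmod_two_eq_zero_iff _).1
            (congrArg (fun f => f (Sum.inl ⟨x, hx⟩)) h0)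
        · exact (intCast_zmod_two_eq_zero_iff _).1
            (congrArg (fun f => f (Sum.inr ⟨x, hx⟩)) h0)
      · rintro ⟨h1, h2⟩
        ext x
        rcases x with x | x
        · exact (intCast_zmod_two_eq_zero_iff _).2 (h1 x x.2)
        · exact (intCast_zmod_two_eq_zero_iff _).2 (h2 x x.2)
    rw [hev]
    constructor
    · rintro ⟨h1, h2⟩
      obtain ⟨g1, hg1⟩ := exists_eq_add_of_invariant hc hi (sigma_sigma α) hm.1 h1
      obtain ⟨g2, hg2⟩ := exists_eq_add_of_invariant hc hi (s := phi α * sigma α)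
        phi_sigma_involutive hm.2 h2
      refine ⟨(g1, g2), ?_⟩
      rw [reflPair_eq_iff, hn.neg_one_pow]
      refine ⟨fun x => ?_, fun x => ?_⟩
      · rw [hg1]; ring
      · rw [hg2, one_mul, add_comm]; rfl
    · rintro ⟨y, hy⟩
      rw [reflPair_eq_iff, hn.neg_one_pow] at hy
      refine ⟨fun x hx => ?_, fun x hx => ?_⟩
      · rw [← hy.1, hx, one_mul]; exact Even.add_self _
      · change phi α (sigma α x) = x at hx
        rw [← hy.2, hx, one_mul]; exact Even.add_self _

theorem nonempty_homZZ2_odd_of_two_le [CompactSpace X] [T2Space X] [TotallyDisconnectedSpace X]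
    {h : X → ℝ} (hc : Continuous h) (hi : Function.Injective h) {n : ℕ} (hn : Odd n) :
    Nonempty (homZZ2 α (n + 2) ≃+
      C(Function.fixedPoints (sigma α) ⊕ Function.fixedPoints (phi α * sigma α), ZMod 2)) :=
  nonempty_homZZ2_odd hc hi hn.add_one fun m => by
    change reflPair α _ m = 0 ↔ _
    rw [hn.neg_one_pow]

/-- A one-cycle `(f₁, f₂)` has `f₁ ∘ σ - f₁` anti-invariant under `σ` and invariant under `φ`. -/
theorem cycle_defect {m : C(X, ℤ) × C(X, ℤ)} (hm : IsCyclePair α 0 m) (x : X) :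
    m.1 (sigma α (phi α x)) - m.1 (phi α x) = m.1 (sigma α x) - m.1 x := by
  rw [isCyclePair_zero_iff] at hm
  have h1 := hm (phi α x)
  have h2 := hm (sigma α x)
  rw [phi_sigma_phi] at h1
  rw [sigma_sigma] at h2
  linarith

/-- The defect `f₁ ∘ σ - f₁` is `φ`-invariant, hence constant, and it changes sign under `σ`, hence
is zero. -/
theorem isCyclePair_zero_iff_of_minimal (hφ : IsMinimalAction (zAction (phi α)))
    (m : C(X, ℤ) × C(X, ℤ)) : IsCyclePair α 0 m ↔ reflPair α (-1) m = 0 := by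
  constructor
  · intro hm
    have h0 : ∀ x, m.1 (sigma α x) - m.1 x = 0 := fun x => by
      have := eq_of_invariant_of_isMinimal_zAction hφ
        (f := fun x => m.1 (sigma α x) - m.1 x) (by fun_prop) (cycle_defect hm) (sigma α x) x
      simp only [sigma_sigma] at this
      linarith
    rw [isCyclePair_zero_iff] at hm
    rw [reflPair_eq_iff]
    refine ⟨fun x => ?_, fun x => ?_⟩
    · have := h0 x
      simp
      linarith
    · have := h0 x
      have := hm x
      simp
      linarith
  · intro hm
    rw [IsCyclePair, hm]
    simp

theorem subsingleton_fixed_of_forall_ne (h1 : ∀ x, sigma α x ≠ x)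
    (h2 : ∀ x, phi α (sigma α x) ≠ x) : Subsingleton
      C(Function.fixedPoints (sigma α) ⊕ Function.fixedPoints (phi α * sigma α), ZMod 2) := by
  have : IsEmpty (Function.fixedPoints (sigma α) ⊕ Function.fixedPoints (phi α * sigma α)) :=
    ⟨fun x => x.elim (fun x => h1 _ x.2) fun x => h2 _ x.2⟩
  exact ⟨fun f g => ContinuousMap.ext fun x => isEmptyElim x⟩

/-- The first homology of `ℤ ⋊ ℤ/2` with coefficients in `C(X, ℤ)` if `X` is the union of a minimal
clopen set and its image under `σ`. -/
theorem nonempty_homZZ2_one_of_clopen {h : X → ℝ} (hc : Continuous h) (hi : Function.Injective h)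
    {Y : Set X} (hYc : IsClopen Y) (hY : ∀ x, phi α x ∈ Y ↔ x ∈ Y)
    (hσ : ∀ x, sigma α x ∈ Y ↔ x ∉ Y) {y : X} (hy : y ∈ Y)
    (hd : closure (Set.range fun g => zAction (phi α) g y) = Y) :
    Nonempty (homZZ2 α 1 ≃+ ℤ) := by
  have hfix : ∀ x, sigma α x ≠ x := fun x e => by
    have := hσ x
    rw [e] at this
    exact iff_not_self this
  have hfix' : ∀ x, phi α (sigma α x) ≠ x := fun x e => by
    have := (hY (sigma α x)).trans (hσ x)
    rw [e] at this
    exact iff_not_self this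
  -- The defect is constant on `Y`, and its values on `σ(Y)` are the negatives, so its value at `y`
  -- determines it.
  refine nonempty_homZZ2_addEquiv α 0 (AddMonoidHom.mk'
    (fun m => m.1 (sigma α y) - m.1 y) fun a b => ?_) (fun n => ?_) fun m hm => ?_
  · simp
    ring
  -- Both reflections exchange `Y` and its complement, so the two contributions cancel, while the
  -- defect at `y` is `0 - (-n) = n`.
  · refine ⟨(-n • charMap Y hYc, n • charMap Y hYc), ?_, ?_⟩
    · rw [isCyclePair_zero_iff]
      intro x
      by_cases hx : x ∈ Y
      · have hx' : sigma α x ∉ Y := fun h' => (hσ x).1 h' hx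
        have hx'' : phi α (sigma α x) ∉ Y := fun h' => hx' ((hY _).1 h')
        simp [charMap_of_mem hYc hx, charMap_of_notMem hYc hx', charMap_of_notMem hYc hx'']
      · have hx' : sigma α x ∈ Y := (hσ x).2 hx
        have hx'' : phi α (sigma α x) ∈ Y := (hY _).2 hx'
        simp [charMap_of_notMem hYc hx, charMap_of_mem hYc hx', charMap_of_mem hYc hx'']
    · have hy' : sigma α y ∉ Y := fun h' => (hσ y).1 h' hy
      simp [charMap_of_mem hYc hy, charMap_of_notMem hYc hy']
  · have key : m.1 (sigma α y) - m.1 y = 0 ↔ reflPair α (-1) m = 0 := by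
      constructor
      · intro h0
        have hzY : ∀ x ∈ Y, m.1 (sigma α x) - m.1 x = 0 := by
          have : Y ⊆ {x | m.1 (sigma α x) - m.1 x = 0} := by
            rw [← hd]
            refine closure_minimal ?_ (isClosed_eq (by fun_prop) continuous_const)
            rintro _ ⟨g, rfl⟩
            exact (zpow_apply_mem (φ := phi α) (S := {x | m.1 (sigma α x) - m.1 x = 0})
              (fun x => by
                change _ = _ ↔ _ = _
                rw [cycle_defect hm]) g.toAdd y).2 h0
          exact this
        have hz : ∀ x, m.1 (sigma α x) - m.1 x = 0 := fun x => by
          by_cases hx : x ∈ Y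
          · exact hzY x hx
          · have := hzY _ ((hσ x).2 hx)
            rw [sigma_sigma] at this
            linarith
        rw [isCyclePair_zero_iff] at hm
        rw [reflPair_eq_iff]
        refine ⟨fun x => ?_, fun x => ?_⟩
        · have := hz x
          simp
          linarith
        · have := hz x
          have := hm x
          simp
          linarith
      · intro h0
        rw [reflPair_eq_iff] at h0
        simpa [sub_eq_add_neg] using h0.1 y
    refine key.trans ?_
    rw [reflPair_eq_iff]
    constructor
    · rintro ⟨h1, h2⟩
      obtain ⟨g1, hg1⟩ := exists_eq_add_of_invariant hc hi (s := sigma α) (f := m.1)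
        (sigma_sigma α) (fun x => by simpa [← sub_eq_add_neg, sub_eq_zero] using h1 x)
        fun x hx => (hfix x hx).elim
      obtain ⟨g2, hg2⟩ := exists_eq_add_of_invariant hc hi (s := phi α * sigma α) (f := m.2)
        phi_sigma_involutive (fun x => by simpa [← sub_eq_add_neg, sub_eq_zero] using h2 x)
        fun x hx => (hfix' x hx).elim
      refine ⟨(g1, g2), ?_⟩
      rw [reflPair_eq_iff]
      refine ⟨fun x => ?_, fun x => ?_⟩
      · rw [hg1]; simp; ring
      · rw [hg2]; simp; ring
    · rintro ⟨y, rfl⟩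
      simp [reflPair, sigma_sigma, phi_sigma_phi]
      exact ⟨fun x => by ring, fun x => by ring⟩

end Higher

/-- If the kernel of a surjection from a group onto a group without two-torsion is generated by an
element of order two, then the surjection splits. -/
theorem nonempty_addEquiv_zmod_two_prod {M A B : Type*} [AddCommGroup M] [AddCommGroup A]
    [AddCommGroup B] (p : M →+ A) (q : M →+ B) (hp : Function.Surjective p)
    (hq : Function.Surjective q) (hpq : ∀ x, p x = 0 → q x = 0) (t : M) (hqt : q t = 0)
    (hpt : p t ≠ 0) (hker : ∀ x, q x = 0 → p x = 0 ∨ p x = p t)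
    (htor : ∀ x, q (x + x) = 0 → q x = 0) : Nonempty (A ≃+ ZMod 2 × B) := by
  have htt : p (t + t) = 0 := by
    rcases hker (t + t) (by simp [hqt]) with h | h
    · exact h
    · rw [map_add] at h
      exact (hpt (by simpa using h)).elim
  let D : AddSubgroup A := (AddMonoidHom.mk' (fun a : A => a + a) fun a b => by abel).range
  let _ : Module (ZMod 2) (A ⧸ D) := AddCommGroup.zmodModule fun x => by
    obtain ⟨a, rfl⟩ := QuotientAddGroup.mk_surjective x
    rw [two_nsmul, ← QuotientAddGroup.mk_add]
    exact (QuotientAddGroup.eq_zero_iff _).2 ⟨a, rfl⟩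
  -- `p t` is not divisible by two: if `p t = 2 p x`, then `q (2x) = 0`, so `q x = 0` and `p x` is
  -- `0` or `p t`; either way `2 p x = 0`.
  have ht : (QuotientAddGroup.mk (p t) : A ⧸ D) ≠ 0 := by
    intro h
    obtain ⟨a, ha⟩ := (QuotientAddGroup.eq_zero_iff _).1 h
    obtain ⟨x, rfl⟩ := hp a
    have hx : p (x + x) = p t := (map_add p x x).trans ha
    have hqx : q (x + x) = 0 := by
      have : p (x + x - t) = 0 := by rw [map_sub, hx, sub_self]
      have := hpq _ this
      rwa [map_sub, hqt, sub_zero] at this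
    have hx2 : p (x + x) = 0 := by
      rcases hker x (htor x hqx) with h | h
      · rw [map_add, h, add_zero]
      · rw [map_add, h, ← map_add, htt]
    exact hpt (hx.symm.trans hx2)
  -- A functional on the `ZMod 2`-vector space `A / 2A` that is nonzero on `p t` supplies the
  -- projection to `ZMod 2`.
  obtain ⟨r, hr⟩ : ∃ r : Module.Dual (ZMod 2) (A ⧸ D), r (QuotientAddGroup.mk (p t)) ≠ 0 := by
    by_contra! h
    exact ht ((Module.forall_dual_apply_eq_zero_iff (ZMod 2) _).1 h)
  let r' : M →+ ZMod 2 := r.toAddMonoidHom.comp ((QuotientAddGroup.mk' D).comp p)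
  have hr' : r' t = 1 := by
    have : ∀ c : ZMod 2, c ≠ 0 → c = 1 := by decide
    exact this _ hr
  have hrp : ∀ x, p x = 0 → r' x = 0 := fun x hx => by
    change r (QuotientAddGroup.mk' D (p x)) = 0
    rw [hx, map_zero, map_zero]
  have htwo : ∀ c : ZMod 2, c = 0 ∨ c = 1 := by decide
  refine nonempty_addEquiv_of_surjective p (r'.prod q) hp ?_ fun x => ?_
  · rintro ⟨c, b⟩
    obtain ⟨x, rfl⟩ := hq b
    rcases htwo (c - r' x) with h | h
    · exact ⟨x, Prod.ext (sub_eq_zero.1 h).symm rfl⟩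
    · refine ⟨x + t, Prod.ext ?_ ?_⟩
      · change r' (x + t) = c
        rw [map_add, hr', ← h]
        abel
      · change q (x + t) = q x
        rw [map_add, hqt, add_zero]
  · rw [AddMonoidHom.prod_apply, Prod.mk_eq_zero]
    refine ⟨fun h => ⟨hrp x h, hpq x h⟩, fun ⟨h1, h2⟩ => (hker x h2).resolve_right fun h => ?_⟩
    have := hrp (x - t) (by rw [map_sub, h, sub_self])
    rw [map_sub, h1, hr'] at this
    exact absurd this (by decide)

/-! ### Homology in degree zero -/

section ZerothHomology

variable {X : Type} [TopologicalSpace X] {α : ZZ2 →* (X ≃ₜ X)}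

/-- In `f + f ∘ σ` the `σ`-coboundary cancels, and the part `u - u ∘ φ` becomes the `φ`-coboundary
of `g = u - u ∘ φσ`. The second conclusion says that this `g` has constant `c = 0`. -/
theorem exists_of_toH0_eq_zero {f : C(X, ℤ)} (hf : toH0 α f = 0) :
    ∃ g : C(X, ℤ), (∀ x, f x + f (sigma α x) = g x - g (phi α x)) ∧
      ∀ x, g x + g (phi α (sigma α x)) = 0 := by
  obtain ⟨u, v, h⟩ := (toH0_ZZ2_eq_zero_iff α f).1 hf
  refine ⟨u - u.comp ((phi α * sigma α : X ≃ₜ X) : C(X, X)), fun x => ?_, fun x => ?_⟩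
  · simp [h, sigma_sigma, phi_sigma_phi]
    ring
  · simp [phi_sigma_phi, sigma_sigma]

theorem toOnePlusSigma_eq_zero_of_toH0_eq_zero {f : C(X, ℤ)} (hf : toH0 α f = 0) :
    toOnePlusSigma α f = 0 := by
  obtain ⟨g, hg, -⟩ := exists_of_toH0_eq_zero hf
  exact (toOnePlusSigma_eq_zero_iff α f).2 ⟨g, hg⟩

/-- The left side of the hypothesis is `σ`-invariant, hence so is `g - g ∘ φ`. This makes `g + g ∘
φσ` invariant under both `φ` and `σ`. -/
theorem exists_const_of_coboundary (hα : IsMinimalAction α) [Nonempty X] {f g : C(X, ℤ)}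
    (hg : ∀ x, f x + f (sigma α x) = g x - g (phi α x)) :
    ∃ c : ℤ, ∀ x, g x + g (phi α (sigma α x)) = c := by
  have h2 : ∀ x, g (sigma α x) + g (phi α x) = g x + g (phi α (sigma α x)) := fun x => by
    have h1 := hg x
    have h2 := hg (sigma α x)
    rw [sigma_sigma] at h2
    linarith
  obtain ⟨y⟩ := ‹Nonempty X›
  refine ⟨g y + g (phi α (sigma α y)), fun x => eq_of_invariant hα
    (f := fun x => g x + g (phi α (sigma α x))) (by fun_prop) (fun x => ?_) (fun x => ?_) x y⟩
  · rw [phi_sigma_phi, ← h2 x]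
    ring
  · rw [sigma_sigma, h2]

/-- Subtracting `c / 2` makes `g` anti-invariant under `φσ` and then `f - g` anti-invariant under
`σ`; both are therefore coboundaries of the respective reflections. -/
theorem toH0_eq_zero_of_even {h : X → ℝ} (hc : Continuous h) (hi : Function.Injective h)
    {f g : C(X, ℤ)} (hg : ∀ x, f x + f (sigma α x) = g x - g (phi α x)) {c : ℤ}
    (hgc : ∀ x, g x + g (phi α (sigma α x)) = c) (heven : Even c) : toH0 α f = 0 := by
  obtain ⟨d, rfl⟩ := heven
  let g' : C(X, ℤ) := g - ContinuousMap.const X d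
  have hg' : ∀ x, g' x = g x - d := fun _ => rfl
  obtain ⟨k, hk⟩ := exists_eq_sub_of_anti hc hi (s := phi α * sigma α) (f := g')
    phi_sigma_involutive fun x => by
      change g' (phi α (sigma α x)) = _
      rw [hg', hg']
      have := hgc x
      linarith
  obtain ⟨v, hv⟩ := exists_eq_sub_of_anti hc hi (s := sigma α) (f := f - g')
    (sigma_sigma α) fun x => by
      have h1 := hg x
      have h2 := hgc (sigma α x)
      rw [sigma_sigma] at h2
      change f (sigma α x) - g' (sigma α x) = -(f x - g' x)
      rw [hg', hg']
      linarith
  refine (toH0_ZZ2_eq_zero_iff α f).2 ⟨k, v + k.comp (phi α : C(X, X)), fun x => ?_⟩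
  have h1 : g' x = k x - k (phi α (sigma α x)) := hk x
  have h2 := hv x
  rw [ContinuousMap.sub_apply] at h2
  simp
  linarith

/-- At a fixed point of `σ` the equations give `c = 2(g x - f x)`, at one of `φσ` they give `c = 2 g
x`. -/
theorem even_of_exists_fixed {f g : C(X, ℤ)}
    (hg : ∀ x, f x + f (sigma α x) = g x - g (phi α x)) {c : ℤ}
    (hgc : ∀ x, g x + g (phi α (sigma α x)) = c) {x : X}
    (hx : sigma α x = x ∨ phi α (sigma α x) = x) : Even c := by
  have h1 := hg x
  have h2 := hgc x
  rcases hx with hx | hx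
  · rw [hx] at h1 h2
    exact ⟨g x - f x, by linarith⟩
  · rw [hx] at h2
    exact ⟨g x, by linarith⟩

/-- If `σ` or `φσ` has a fixed point, then the zeroth homology is `(1 + σ_*) H_0(ℤ, C(X, ℤ))`. -/
theorem nonempty_homZZ2_zero_of_fixed {h : X → ℝ} (hc : Continuous h)
    (hi : Function.Injective h) (hα : IsMinimalAction α) {x : X}
    (hx : sigma α x = x ∨ phi α (sigma α x) = x) :
    Nonempty (homZZ2 α 0 ≃+ onePlusSigma α) := by
  have : Nonempty X := ⟨x⟩
  refine nonempty_addEquiv_of_surjective (toH0 α) (toOnePlusSigma α) (toH0_surjective α)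
    (toOnePlusSigma_surjective α) fun f => ⟨toOnePlusSigma_eq_zero_of_toH0_eq_zero, fun hf => ?_⟩
  obtain ⟨g, hg⟩ := (toOnePlusSigma_eq_zero_iff α f).1 hf
  obtain ⟨c, hgc⟩ := exists_const_of_coboundary hα hg
  exact toH0_eq_zero_of_even hc hi hg hgc (even_of_exists_fixed hg hgc hx)

/-- The target has no two-torsion: `g` mod 2 is `φ`-invariant, hence constant, so rounding in `g /
2` loses the same amount at `x` and `φ x`. -/
theorem toOnePlusSigma_eq_zero_of_add_self (hφ : IsMinimalAction (zAction (phi α))) [Nonempty X]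
    {f : C(X, ℤ)} (hf : toOnePlusSigma α (f + f) = 0) : toOnePlusSigma α f = 0 := by
  rw [toOnePlusSigma_eq_zero_iff] at hf ⊢
  obtain ⟨g, hg⟩ := hf
  simp only [ContinuousMap.add_apply] at hg
  obtain ⟨y⟩ := ‹Nonempty X›
  have hmod : ∀ x, g x % 2 = g y % 2 := fun x =>
    eq_of_invariant_of_isMinimal_zAction hφ (f := fun x => g x % 2)
      ((continuous_of_discreteTopology (f := fun n : ℤ => n % 2)).comp g.continuous)
      (fun x => by have := hg x; omega) x y
  refine ⟨⟨fun x => g x / 2,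
    (continuous_of_discreteTopology (f := fun n : ℤ => n / 2)).comp g.continuous⟩, fun x => ?_⟩
  change _ = g x / 2 - g (phi α x) / 2
  have h1 := hg x
  have h2 := hmod x
  have h3 := hmod (phi α x)
  omega

/-- If `φ` is minimal and the action is free, then the zeroth homology is the sum of `ℤ/2` and
`(1 + σ_*) H_0(ℤ, C(X, ℤ))`. -/
theorem nonempty_homZZ2_zero_of_free {h : X → ℝ} (hc : Continuous h)
    (hi : Function.Injective h) (hα : IsMinimalAction α) [Nonempty X]
    (hφ : IsMinimalAction (zAction (phi α))) (hfix : ∀ x, sigma α x ≠ x)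
    (hfix' : ∀ x, phi α (sigma α x) ≠ x) :
    Nonempty (homZZ2 α 0 ≃+ ZMod 2 × onePlusSigma α) := by
  -- `gV` and `gU` play the role of indicators of fundamental domains for `σ` and `φσ`; `gU - gV` is
  -- then a class with `c = 1`.
  obtain ⟨gV, hV⟩ := exists_eq_add_of_invariant hc hi (s := sigma α) (f := 1)
    (sigma_sigma α) (fun _ => rfl) fun x hx => (hfix x hx).elim
  obtain ⟨gU, hU⟩ := exists_eq_add_of_invariant hc hi (s := phi α * sigma α) (f := 1)
    phi_sigma_involutive (fun _ => rfl) fun x hx => (hfix' x hx).elim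
  replace hU : ∀ x, gU x + gU (phi α (sigma α x)) = 1 := fun x => (hU x).symm
  replace hV : ∀ x, gV x + gV (sigma α x) = 1 := fun x => (hV x).symm
  have ht : ∀ x, (gU - gV) x + (gU - gV) (sigma α x) = gU x - gU (phi α x) := fun x => by
    have h1 := hU (sigma α x)
    have h2 := hV x
    rw [sigma_sigma] at h1
    rw [ContinuousMap.sub_apply, ContinuousMap.sub_apply]
    linarith
  refine nonempty_addEquiv_zmod_two_prod (toH0 α) (toOnePlusSigma α) (toH0_surjective α)
    (toOnePlusSigma_surjective α) (fun _ => toOnePlusSigma_eq_zero_of_toH0_eq_zero) (gU - gV)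
    ((toOnePlusSigma_eq_zero_iff α _).2 ⟨gU, ht⟩) (fun h0 => ?_) (fun f hf => ?_)
    fun f => toOnePlusSigma_eq_zero_of_add_self hφ
  -- If the class vanished, `g - gU` would be a constant, and adding its values at `y` and `φσ y`
  -- would make twice that constant equal to `-1`.
  · obtain ⟨g, hg, hg0⟩ := exists_of_toH0_eq_zero h0
    obtain ⟨y⟩ := ‹Nonempty X›
    have hk := eq_of_invariant_of_isMinimal_zAction hφ (f := fun x => g x - gU x) (by fun_prop)
      (fun x => by have := hg x; have := ht x; linarith) y (phi α (sigma α y))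
    have h1 := hg0 y
    have h2 := hU y
    omega
  · obtain ⟨g, hg⟩ := (toOnePlusSigma_eq_zero_iff α f).1 hf
    obtain ⟨c, hgc⟩ := exists_const_of_coboundary hα hg
    rcases Int.even_or_odd c with hcc | hcc
    · exact Or.inl (toH0_eq_zero_of_even hc hi hg hgc hcc)
    · refine Or.inr ?_
      rw [← sub_eq_zero, ← map_sub]
      refine toH0_eq_zero_of_even hc hi (f := f - (gU - gV)) (g := g - gU) (c := c - 1)
        (fun x => ?_) (fun x => ?_) (hcc.sub_odd odd_one)
      · have h1 := hg x
        have h2 := ht x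
        simp only [ContinuousMap.sub_apply] at h2 ⊢
        linarith
      · have h1 := hgc x
        have h2 := hU x
        simp only [ContinuousMap.sub_apply]
        linarith

theorem exists_extension_by_zero {Y : Set X} (hY : IsClopen Y) (g : C(Y, ℤ)) :
    ∃ G : C(X, ℤ), (∀ y : Y, G y = g y) ∧ ∀ x ∉ Y, G x = 0 := by
  classical
  refine ⟨⟨fun x => if hx : x ∈ Y then g ⟨x, hx⟩ else 0, ?_⟩, fun y => ?_, fun x hx => ?_⟩
  · rw [continuous_iff_continuousAt]
    intro x
    by_cases hx : x ∈ Y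
    · have : ContinuousAt (fun y : Y => if hx : (y : X) ∈ Y then g ⟨y, hx⟩ else 0) ⟨x, hx⟩ := by
        simpa using g.continuous.continuousAt
      exact (hY.isOpen.isOpenEmbedding_subtypeVal.continuousAt_iff (x := ⟨x, hx⟩)).1 this
    · refine (continuousAt_const (y := (0 : ℤ))).congr ?_
      filter_upwards [hY.isClosed.isOpen_compl.mem_nhds hx] with z hz
      have hz' : z ∉ Y := hz
      simp [hz']
  · exact dif_pos y.2
  · exact dif_neg hx

/-- The map sending `f` to the restriction of `f + f ∘ σ` to a subset. -/
def restrictFold (α : ZZ2 →* (X ≃ₜ X)) (Y : Set X) : C(X, ℤ) →+ C(Y, ℤ) where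
  toFun f := (f + f.comp (sigma α : C(X, X))).comp ⟨Subtype.val, continuous_subtype_val⟩
  map_zero' := rfl
  map_add' a b := by
    ext x
    simp
    ring

theorem restrictFold_apply (Y : Set X) (f : C(X, ℤ)) (y : Y) :
    restrictFold α Y f y = f y + f (sigma α y) := rfl

theorem restrictFold_surjective {Y : Set X} (hYc : IsClopen Y)
    (hσ : ∀ x, sigma α x ∈ Y ↔ x ∉ Y) : Function.Surjective (restrictFold α Y) := fun g => by
  obtain ⟨G, hG, hG0⟩ := exists_extension_by_zero hYc g
  refine ⟨G, ContinuousMap.ext fun y => ?_⟩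
  rw [restrictFold_apply, hG, hG0 _ (fun h' => (hσ y).1 h' y.2), add_zero]

theorem toH0_eq_zero_iff_restrictFold {Y : Set X} (hYc : IsClopen Y) (hYφ : phi α '' Y = Y)
    (hY : ∀ x, phi α x ∈ Y ↔ x ∈ Y) (hσ : ∀ x, sigma α x ∈ Y ↔ x ∉ Y) (f : C(X, ℤ)) :
    toH0 α f = 0 ↔ ∃ g : C(Y, ℤ), ∀ y,
      restrictFold α Y f y = g y - g (restrictHomeo (phi α) Y hYφ y) := by
  have hres : ∀ y : Y, ((restrictHomeo (phi α) Y hYφ y : Y) : X) = phi α y := fun _ => rfl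
  constructor
  · intro hf
    obtain ⟨g, hg, -⟩ := exists_of_toH0_eq_zero hf
    exact ⟨g.comp ⟨Subtype.val, continuous_subtype_val⟩, fun y => hg y⟩
  · rintro ⟨g, hg⟩
    obtain ⟨G, hG, hG0⟩ := exists_extension_by_zero hYc g
    -- The `σ`-coboundary moves the values of `f` on `σ(Y)` over to `Y`, where `G` accounts for the
    -- sum.
    refine (toH0_ZZ2_eq_zero_iff α f).2
      ⟨G, - (f.comp (sigma α : C(X, X)) * charMap Y hYc), fun x => ?_⟩
    by_cases hx : x ∈ Y
    · have h1 := hg ⟨x, hx⟩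
      rw [restrictFold_apply, ← hG, ← hG, hres] at h1
      have hx' : sigma α x ∉ Y := fun h' => (hσ x).1 h' hx
      simp [charMap_of_mem hYc hx, charMap_of_notMem hYc hx']
      linarith
    · have hx' : sigma α x ∈ Y := (hσ x).2 hx
      simp [charMap_of_notMem hYc hx, charMap_of_mem hYc hx', hG0 x hx,
        hG0 _ (fun h' => hx ((hY x).1 h')), sigma_sigma]

/-- If `X` is the union of a clopen `φ`-invariant set and its image under `σ`, then the zeroth
homology is that of the restriction of `φ`. -/
theorem nonempty_homZZ2_zero_of_clopen {Y : Set X} (hYc : IsClopen Y) (hYφ : phi α '' Y = Y)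
    (hY : ∀ x, phi α x ∈ Y ↔ x ∈ Y) (hσ : ∀ x, sigma α x ∈ Y ↔ x ∉ Y) :
    Nonempty (homZZ2 α 0 ≃+ homZ (restrictHomeo (phi α) Y hYφ) 0) := by
  have hq : Function.Surjective
      ((toH0 (zAction (restrictHomeo (phi α) Y hYφ))).comp (restrictFold α Y)) := by
    rw [AddMonoidHom.coe_comp]
    exact (toH0_surjective _).comp (restrictFold_surjective hYc hσ)
  refine nonempty_addEquiv_of_surjective (toH0 α) _ (toH0_surjective α) hq fun f => ?_
  rw [AddMonoidHom.comp_apply, toH0_zAction_eq_zero_iff,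
    toH0_eq_zero_iff_restrictFold hYc hYφ hY hσ f]

end ZerothHomology

end CantorDihedral
end

/-! ### Assembly of the three cases -/

theorem mainTheorem3 (X : Type) [TopologicalSpace X] (hX : Nonempty (X ≃ₜ cantorSet))
    (α : ZZ2 →* (X ≃ₜ X)) (hα : IsMinimalAction α) :
    (¬ IsMinimalAction (zAction (phi α)) →
      (∃ (Y : Set X) (hY : phi α '' Y = Y),
        IsClopen Y ∧ Disjoint Y (sigma α '' Y) ∧
        Y ∪ sigma α '' Y = Set.univ ∧
        IsMinimalAction (zAction
          (restrictHomeo (phi α) Y hY)) ∧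
        Nonempty (homZZ2 α 0 ≃+
          homZ (restrictHomeo (phi α) Y hY) 0)) ∧
      Nonempty (homZZ2 α 1 ≃+ ℤ) ∧
      ∀ n : ℕ, 2 ≤ n → Subsingleton (homZZ2 α n)) ∧
    (IsMinimalAction (zAction (phi α)) →
      IsFreeAction α →
      Nonempty (homZZ2 α 0 ≃+ ZMod 2 × onePlusSigma α) ∧
      ∀ n : ℕ, 1 ≤ n → Subsingleton (homZZ2 α n)) ∧
    (¬ IsFreeAction α →
      Nonempty (homZZ2 α 0 ≃+ onePlusSigma α) ∧
      (∀ n : ℕ, 1 ≤ n → Nonempty (homZZ2 α (2 * n - 1) ≃+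
        C(Function.fixedPoints (sigma α) ⊕
          Function.fixedPoints (phi α * sigma α), ZMod 2))) ∧
      ∀ n : ℕ, 1 ≤ n → Subsingleton (homZZ2 α (2 * n))) := by
  obtain ⟨e⟩ := hX
  let E : X ≃ₜ (ℕ → Bool) := e.trans cantorSetHomeomorphNatToBool
  have : CompactSpace X := E.symm.compactSpace
  have : T2Space X := E.isEmbedding.t2Space
  have : TotallyDisconnectedSpace X :=
    E.isEmbedding.isTotallyDisconnected_range.1 (isTotallyDisconnected_of_totallyDisconnectedSpace _)
  have : Infinite X := E.toEquiv.infinite_iff.2 inferInstance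
  have : Nonempty X := inferInstance
  -- The inclusion of the Cantor set in the line provides the order by which fundamental domains are
  -- chosen.
  have hc : Continuous fun x => (e x : ℝ) := continuous_subtype_val.comp e.continuous
  have hi : Function.Injective fun x => (e x : ℝ) := Subtype.val_injective.comp e.injective
  have heven : ∀ {n : ℕ}, Even n → Subsingleton (homZZ2 α (n + 2)) :=
    fun hn => subsingleton_homZZ2_even hc hi hn
  refine ⟨fun hφ => ?_, fun hφ hfree => ?_, fun hfree => ?_⟩
  · obtain ⟨Y, hYc, hY, hσ, hd⟩ := exists_clopen_minimal hα hφ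
    have hYφ : phi α '' Y = Y := by
      ext x
      constructor
      · rintro ⟨y, hy, rfl⟩
        exact (hY y).2 hy
      · intro hx
        have h := (phi α).apply_symm_apply x
        exact ⟨(phi α).symm x, (hY _).1 (by rwa [h]), h⟩
    have himg : ∀ x, x ∈ sigma α '' Y ↔ x ∉ Y := by
      intro x
      rw [← hσ]
      constructor
      · rintro ⟨y, hy, rfl⟩
        rwa [sigma_sigma]
      · intro hx
        exact ⟨_, hx, sigma_sigma α x⟩
    have hyne : ∃ y, y ∈ Y := by
      obtain ⟨x⟩ := ‹Nonempty X›
      by_cases hx : x ∈ Y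
      · exact ⟨x, hx⟩
      · exact ⟨_, (hσ x).2 hx⟩
    obtain ⟨y, hy⟩ := hyne
    have hfix : ∀ x, sigma α x ≠ x := fun x e => by
      have := hσ x
      rw [e] at this
      exact iff_not_self this
    have hfix' : ∀ x, phi α (sigma α x) ≠ x := fun x e => by
      have := (hY (sigma α x)).trans (hσ x)
      rw [e] at this
      exact iff_not_self this
    refine ⟨⟨Y, hYφ, hYc, ?_, ?_, ?_, nonempty_homZZ2_zero_of_clopen hYc hYφ hY hσ⟩,
      nonempty_homZZ2_one_of_clopen hc hi hYc hY hσ hy (hd y hy), fun n hn => ?_⟩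
    · exact Set.disjoint_left.2 fun x hx hx' => (himg x).1 hx' hx
    · exact Set.eq_univ_of_forall fun x => (em (x ∈ Y)).imp id (himg x).2
    · intro z
      rw [Subtype.dense_iff]
      intro w hw
      rw [← hd z z.2] at hw
      convert hw using 2
      ext x
      simp only [Set.mem_image, Set.mem_range, exists_exists_eq_and]
      refine exists_congr fun g => ?_
      exact Eq.congr_left (restrictHomeo_zpow (phi α) Y hYφ g.toAdd z)
    · obtain ⟨n, rfl⟩ := Nat.exists_eq_add_of_le' hn
      rcases Nat.even_or_odd n with h | h
      · exact heven h
      · have := subsingleton_fixed_of_forall_ne hfix hfix'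
        exact (nonempty_homZZ2_odd_of_two_le hc hi h).elim fun E => E.toEquiv.subsingleton
  · have hfix : ∀ x, sigma α x ≠ x := fun x e => by
      have := congrArg (fun g : ZZ2 => g.right) (hfree _ x e)
      exact absurd this (by decide)
    have hfix' : ∀ x, phi α (sigma α x) ≠ x := fun x e => by
      have h : α (refl false) x = x := (DFunLike.congr_fun (map_mul α _ _) x).trans e
      have := congrArg (fun g : ZZ2 => g.right) (hfree _ x h)
      exact absurd this (by decide)
    have hs := subsingleton_fixed_of_forall_ne hfix hfix'
    refine ⟨nonempty_homZZ2_zero_of_free hc hi hα hφ hfix hfix', fun n hn => ?_⟩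
    obtain ⟨n, rfl⟩ := Nat.exists_eq_add_of_le' hn
    rcases n with _ | n
    · exact (nonempty_homZZ2_odd hc hi Even.zero (isCyclePair_zero_iff_of_minimal hφ)).elim
        fun E => E.toEquiv.subsingleton
    rcases Nat.even_or_odd n with h | h
    · exact heven h
    · exact (nonempty_homZZ2_odd_of_two_le hc hi h).elim fun E => E.toEquiv.subsingleton
  · obtain ⟨hφ, x, hx⟩ := minimal_and_exists_fixed_of_not_free hα hfree
    refine ⟨nonempty_homZZ2_zero_of_fixed hc hi hα hx, fun n hn => ?_, fun n hn => ?_⟩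
    · obtain ⟨n, rfl⟩ := Nat.exists_eq_add_of_le' hn
      rcases n with _ | n
      · exact nonempty_homZZ2_odd hc hi Even.zero (isCyclePair_zero_iff_of_minimal hφ)
      · have h : 2 * (n + 1 + 1) - 1 = (2 * n + 1) + 2 := by omega
        rw [h]
        exact nonempty_homZZ2_odd_of_two_le hc hi (odd_two_mul_add_one n)
    · obtain ⟨n, rfl⟩ := Nat.exists_eq_add_of_le' hn
      exact heven (even_two_mul n)
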